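/- Throughout, a tracial $\mathrm{W}^*$-algebra $\mathcal{M}=(M,\tau)$ is a $\mathrm{W}^*$-algebra $M$ with a faithful, weak-$\star$ continuous tracial state $\tau$. These are the models of the theory $\mathrm{T}_{\mathrm{tr}}$ of tracial $\mathrm{W}^*$-algebras in the continuous-logic language $\mathcal{L}_{\mathrm{tr}}$, which has one sort $L^\infty(\mathcal{M})=M$, domains $D_r^{\mathcal{M}}=\{x\in M:\|x\|\le r\}$ for $r>0$, metric $d^{\mathcal{M}}(x,y)=\tau((x-y)^*(x-y))^{1/2}$, function symbols for $0$, $1$, addition, multiplication, adjoint, multiplication by each $\lambda\in\mathbb{C}$ and evaluation of each non-commutative polynomial, and relation symbols $\operatorname{Re}\operatorname{tr}$ and $\operatorname{Im}\operatorname{tr}$. Terms are built from variables and function symbols (so they are interpreted as $*$-polynomials). Quantifier-free formulas are built from $\operatorname{Re}\operatorname{tr}(t)$, $\operatorname{Im}\operatorname{tr}(t)$ and $d(s,t)$ for terms $s,t$ by applying continuous functions $\mathbb{R}^n\to\mathbb{R}$. The quantifier-free type of a tuple $\mathbf{X}$ in $\mathcal{M}$ is the map $\operatorname{tp}_{\mathrm{qf}}^{\mathcal{M}}(\mathbf{X}):\phi\mapsto\phi^{\mathcal{M}}(\mathbf{X})$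 on quantifier-free formulas. For $\mathbf{r}\in(0,\infty)^{\mathbb{N}}$, $\mathbb{S}_{\mathrm{qf},\mathbf{r}}(\mathrm{T}_{\mathrm{tr}})$ is the set of quantifier-free types of tuples $\mathbf{X}\in\prod_j D_{r_j}^{\mathcal{M}}$, over all $\mathcal{M}\models\mathrm{T}_{\mathrm{tr}}$, with the topology of pointwise convergence on formulas. A quantifier-free definable predicate in variables $(x_i)_{i\in I}$, $I$ countable, is a family of functions $\phi^{\mathcal{M}}:L^\infty(\mathcal{M})^{I}\to\mathbb{R}$, $\mathcal{M}\models\mathrm{T}_{\mathrm{tr}}$, such that for every $\mathbf{r}\in(0,\infty)^I$ and $\epsilon>0$ there is a quantifier-free formula $\psi$ with $|\phi^{\mathcal{M}}(\mathbf{X})-\psi^{\mathcal{M}}(\mathbf{X})|<\epsilon$ for all $\mathcal{M}\models\mathrm{T}_{\mathrm{tr}}$ and $\mathbf{X}\in\prod_i D_{r_i}^{\mathcal{M}}$. A quantifier-free definable function is a family of maps $\mathbf{f}^{\mathcal{M}}:L^\infty(\mathcal{M})^{\mathbb{N}}\to L^\infty(\mathcal{M})^{\mathbb{N}}$, $\mathcal{M}\models\mathrm{T}_{\mathrm{tr}}$,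 such that (i) for every $\mathbf{r}$ there is $\mathbf{r}'$ such that $\mathbf{f}^{\mathcal{M}}$ maps $\prod_j D_{r_j}^{\mathcal{M}}$ into $\prod_j D_{r'_j}^{\mathcal{M}}$ for all $\mathcal{M}$, and (ii) for every quantifier-free definable predicate $\phi(\mathbf{x}',\tilde{\mathbf{x}})$ in two $\mathbb{N}$-tuples of variables, $\phi(\mathbf{f}(\mathbf{x}),\tilde{\mathbf{x}})$ is a quantifier-free definable predicate in $(\mathbf{x},\tilde{\mathbf{x}})$. **Theorem.** Let $\mathbf{f}$ be a family of maps $\mathbf{f}^{\mathcal{M}}:L^\infty(\mathcal{M})^{\mathbb{N}}\to L^\infty(\mathcal{M})^{\mathbb{N}}$, one for each $\mathcal{M}\models\mathrm{T}_{\mathrm{tr}}$. Suppose that to each $\mathbf{r}\in(0,\infty)^{\mathbb{N}}$ there has been assigned some $\mathbf{r}'\in(0,\infty)^{\mathbb{N}}$ such that $\mathbf{f}^{\mathcal{M}}$ maps $\prod_j D_{r_j}^{\mathcal{M}}$ into $\prod_j D_{r'_j}^{\mathcal{M}}$ for all $\mathcal{M}\models\mathrm{T}_{\mathrm{tr}}$.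 Then the following are equivalent. 1. $\mathbf{f}$ is a quantifier-free definable function in $\mathcal{L}_{\mathrm{tr}}$ relative to $\mathrm{T}_{\mathrm{tr}}$. 2. For each $k\in\mathbb{N}$, $\phi(\mathbf{x},y)=d(f_k(\mathbf{x}),y)$ is a quantifier-free definable predicate. 3. For each $k\in\mathbb{N}$, $\mathbf{r}\in(0,\infty)^{\mathbb{N}}$, $\mu\in\mathbb{S}_{\mathrm{qf},\mathbf{r}}(\mathrm{T}_{\mathrm{tr}})$ and $\epsilon>0$, there exist a term $g$ and an open neighborhood $\mathcal{O}$ of $\mu$ in $\mathbb{S}_{\mathrm{qf},\mathbf{r}}(\mathrm{T}_{\mathrm{tr}})$ such that for all $\mathcal{M}\models\mathrm{T}_{\mathrm{tr}}$ and $\mathbf{X}\in\prod_j D_{r_j}^{\mathcal{M}}$ we have $g^{\mathcal{M}}(\mathbf{X})\in D_{r'_k}^{\mathcal{M}}$, and $\operatorname{tp}_{\mathrm{qf}}^{\mathcal{M}}(\mathbf{X})\in\mathcal{O}$ implies $d^{\mathcal{M}}(f_k^{\mathcal{M}}(\mathbf{X}),g^{\mathcal{M}}(\mathbf{X}))<\epsilon$.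 4. For each $k\in\mathbb{N}$, $\mathbf{r}\in(0,\infty)^{\mathbb{N}}$ and $\epsilon>0$, there exist $m\in\mathbb{N}$, quantifier-free formulas $\phi_1,\dots,\phi_m$ and terms $g_1,\dots,g_m$ such that $$\sum_{j=1}^m\phi_j^{\mathcal{M}}(\mathbf{X})\,g_j^{\mathcal{M}}(\mathbf{X})\in D_{r'_k}^{\mathcal{M}}\quad\text{and}\quad d^{\mathcal{M}}\Bigl(f_k^{\mathcal{M}}(\mathbf{X}),\sum_{j=1}^m\phi_j^{\mathcal{M}}(\mathbf{X})\,g_j^{\mathcal{M}}(\mathbf{X})\Bigr)<\epsilon$$ for all $\mathcal{M}\models\mathrm{T}_{\mathrm{tr}}$ and $\mathbf{X}\in\prod_j D_{r_j}^{\mathcal{M}}$. -/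

import Mathlib

universe u

namespace Ltr

/-! ### Tracial W*-algebras (the models of the theory `T_tr`) -/

/-- Weak-star continuity of a linear functional on a W*-algebra `A`: continuity for the topology
that `A` carries as the dual of a Banach space. By Sakai's theorem this topology does not depend
on the choice of the predual. -/
def IsWeakStarContinuous {A : Type u} [CStarAlgebra A] (f : A →ₗ[ℂ] ℂ) : Prop :=
  ∃ (X : Type u) (_ : NormedAddCommGroup X) (_ : NormedSpace ℂ X) (_ : CompleteSpace X)
    (e : StrongDual ℂ X ≃ₗᵢ⋆[ℂ] A),
    Continuous (fun φ : WeakDual ℂ X => f (e (WeakDual.toStrongDual φ)))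

/-- A W*-algebra together with a faithful normal tracial state. -/
structure TracialWStarAlgebra : Type (u + 1) where
  carrier : Type u
  [cstar : CStarAlgebra carrier]
  [wstar : WStarAlgebra carrier]
  tr : carrier →ₗ[ℂ] ℂ
  tr_star_mul_self : ∀ x, 0 ≤ (tr (star x * x)).re ∧ (tr (star x * x)).im = 0
  tr_one : tr 1 = 1
  tr_mul_comm : ∀ x y, tr (x * y) = tr (y * x)
  tr_faithful : ∀ x, tr (star x * x) = 0 → x = 0
  tr_normal : IsWeakStarContinuous tr

attribute [instance] TracialWStarAlgebra.cstar TracialWStarAlgebra.wstar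

instance : CoeSort TracialWStarAlgebra.{u} (Type u) := ⟨TracialWStarAlgebra.carrier⟩

namespace TracialWStarAlgebra

variable (M : TracialWStarAlgebra.{u})

/-- The interpretation of the domain of quantification `D_r`: the operator-norm ball. -/
def D (r : ℝ) : Set M := {x | ‖x‖ ≤ r}

/-- The interpretation of the metric symbol: the distance of the `2`-norm of the trace. -/
noncomputable def d (x y : M) : ℝ := Real.sqrt (M.tr (star (x - y) * (x - y))).re

end TracialWStarAlgebra

/-! ### Terms and quantifier-free formulas of the language `L_tr` -/

/-- Terms in the variables `x_i`, `i : ι`. The symbol `t_p` attached to a non-commutative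
polynomial `p` in `n` variables is applied to `n` terms by `poly`. -/
inductive Term (ι : Type) : Type
  | var (i : ι) : Term ι
  | zero : Term ι
  | one : Term ι
  | add (s t : Term ι) : Term ι
  | mul (s t : Term ι) : Term ι
  | star (t : Term ι) : Term ι
  | smul (c : ℂ) (t : Term ι) : Term ι
  | poly (n : ℕ) (p : FreeAlgebra ℂ (Fin n)) (t : Fin n → Term ι) : Term ι

/-- The interpretation of a term at a tuple of elements of a tracial W*-algebra. -/
noncomputable def Term.eval {ι : Type} (M : TracialWStarAlgebra.{u}) (X : ι → M) : Term ι → M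
  | .var i => X i
  | .zero => 0
  | .one => 1
  | .add s t => s.eval M X + t.eval M X
  | .mul s t => s.eval M X * t.eval M X
  | .star t => Star.star (t.eval M X)
  | .smul c t => c • t.eval M X
  | .poly _ p t => FreeAlgebra.lift ℂ (fun i => (t i).eval M X) p

/-- Quantifier-free formulas in the variables `x_i`, `i : ι`: the relation symbols `d`, `Re tr`,
`Im tr` applied to terms, closed under continuous connectives `ℝⁿ → ℝ`. -/
inductive QFFormula (ι : Type) : Type
  | d (s t : Term ι) : QFFormula ι
  | reTr (t : Term ι) : QFFormula ι
  | imTr (t : Term ι) : QFFormula ι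
  | conn (n : ℕ) (F : C(Fin n → ℝ, ℝ)) (φ : Fin n → QFFormula ι) : QFFormula ι

/-- The interpretation of a quantifier-free formula at a tuple. -/
noncomputable def QFFormula.eval {ι : Type} (M : TracialWStarAlgebra.{u}) (X : ι → M) :
    QFFormula ι → ℝ
  | .d s t => M.d (s.eval M X) (t.eval M X)
  | .reTr t => (M.tr (t.eval M X)).re
  | .imTr t => (M.tr (t.eval M X)).im
  | .conn _ F φ => F (fun i => (φ i).eval M X)

/-! ### Quantifier-free types -/

/-- The quantifier-free type of a tuple. -/
noncomputable def qfType {ι : Type} (M : TracialWStarAlgebra.{u}) (X : ι → M) : QFFormula ι → ℝ :=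
  fun φ => φ.eval M X

/-- The quantifier-free types relative to `T_tr` of tuples in `∏ⱼ D_{rⱼ}`. As a subtype of
`QFFormula ι → ℝ` with its product topology, it carries the weak-star topology, that is, the
topology of pointwise convergence on formulas. -/
def QFTypesOn {ι : Type} (r : ι → ℝ) : Set (QFFormula ι → ℝ) :=
  {μ | ∃ (M : TracialWStarAlgebra.{u}) (X : ι → M), (∀ i, X i ∈ M.D (r i)) ∧ qfType M X = μ}

/-- The quantifier-free type of a tuple in `∏ⱼ D_{rⱼ}` as a point of the type space. -/
noncomputable def qfTypeOn {ι : Type} {r : ι → ℝ} (M : TracialWStarAlgebra.{u}) (X : ι → M)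
    (hX : ∀ i, X i ∈ M.D (r i)) : QFTypesOn.{u} r :=
  ⟨qfType M X, M, X, hX, rfl⟩

/-! ### Quantifier-free definable predicates and functions relative to `T_tr` -/

/-- Quantifier-free definable predicates in the variables `x_i`, `i : ι`: on each product of
domains they are uniform limits of quantifier-free formulas, uniformly over all models. -/
def IsQFDefinablePredicate {ι : Type} (φ : (M : TracialWStarAlgebra.{u}) → (ι → M) → ℝ) : Prop :=
  ∀ r : ι → ℝ, (∀ i, 0 < r i) → ∀ ε : ℝ, 0 < ε → ∃ ψ : QFFormula ι,
    ∀ (M : TracialWStarAlgebra.{u}) (X : ι → M), (∀ i, X i ∈ M.D (r i)) →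
      |φ M X - ψ.eval M X| < ε

/-- Quantifier-free definable functions `f : L^∞(M)^ℕ → L^∞(M)^ℕ`. A predicate
`φ(x', x̃)` in two sequences of variables is a predicate in variables indexed by `ℕ ⊕ ℕ`. -/
structure IsQFDefinableFunction (f : (M : TracialWStarAlgebra.{u}) → (ℕ → M) → (ℕ → M)) :
    Prop where
  maps_domains : ∀ r : ℕ → ℝ, (∀ j, 0 < r j) → ∃ r' : ℕ → ℝ, (∀ j, 0 < r' j) ∧
    ∀ (M : TracialWStarAlgebra.{u}) (X : ℕ → M), (∀ j, X j ∈ M.D (r j)) →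
      ∀ k, f M X k ∈ M.D (r' k)
  comp_predicate : ∀ φ : (M : TracialWStarAlgebra.{u}) → (ℕ ⊕ ℕ → M) → ℝ,
    IsQFDefinablePredicate φ →
      IsQFDefinablePredicate (fun (M : TracialWStarAlgebra.{u}) (Z : ℕ ⊕ ℕ → M) =>
        φ M (Sum.elim (f M (fun j => Z (Sum.inl j))) (fun j => Z (Sum.inr j))))

end Ltr

open Ltr

/-! The central implication is from 2 to 3. A quantifier-free type is realised by a tuple `Y`
generating a tracial W*-algebra `N`, in the sense that the values of terms at `Y` are dense for the
metric of the trace. Since `f` is also defined on `N`, the value `f_k(Y)` lies in `N` and is close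
to the value of a term `g`. A form of Kaplansky's density theorem makes `g` respect the norm bound
in every model at once. By 2, the distance from `f_k(x)` to `g(x)` is uniformly close to a formula
in `x`, so its smallness at one type persists on a neighbourhood.

From 3 to 4, the type space is compact and has partitions of unity made of formulas; convex
combinations preserve both the norm ball and the error estimate. From 4 to 1, formulas are uniformly
continuous on products of domains, and substituting combinations of terms with formula coefficients
into a formula gives a formula, because the real coefficients come out of the trace. From 1 to 2,
the metric is itself a predicate.

Compactness and generating realisations come from one construction, `exists_generating_tuple`:
tuples in many models form one tuple in an ℓ^∞ product, traces have an ultralimit on the C*-algebra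
generated by it, and the commutant of the right multiplications on the GNS space is the required
algebra. Its predual comes from a Dixmier-Ng argument: evaluation at the cyclic vector embeds it in
the Hilbert space, with closed image of the unit ball. The density theorem uses `z ↦ 2 (1 + z z⋆)⁻¹
z`, which maps onto the unit ball, is Lipschitz for the metric of the trace, and is approximated in
norm by `q(z z⋆) z` with `q` a polynomial. -/

open scoped InnerProductSpace ComplexConjugate ENNReal Topology

namespace Ltr

/-! ### Preduals of normed spaces embedded in a Hilbert space -/

section Predual

variable {H : Type*} [NormedAddCommGroup H] [InnerProductSpace ℂ H] [CompleteSpace H]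

/-- Reflexivity of Hilbert spaces. -/
theorem exists_eval_eq_of_bidual (L : StrongDual ℂ (StrongDual ℂ H)) :
    ∃ η : H, ∀ f : StrongDual ℂ H, L f = f η := by
  -- The Riesz map is conjugate-linear; conjugating the value of `L` restores linearity, and `η` is
  -- the Riesz vector of the result.
  let g : H →ₗ[ℂ] ℂ :=
    { toFun := fun h => conj (L (InnerProductSpace.toDual ℂ H h))
      map_add' := fun a b => by simp
      map_smul' := fun c a => by
        rw [LinearIsometryEquiv.map_smulₛₗ, map_smul]; simp }
  let G : StrongDual ℂ H := g.mkContinuous ‖L‖ fun h => by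
    have := L.le_opNorm (InnerProductSpace.toDual ℂ H h)
    simpa [g] using this
  refine ⟨(InnerProductSpace.toDual ℂ H).symm G, fun f => ?_⟩
  obtain ⟨h, rfl⟩ := (InnerProductSpace.toDual ℂ H).surjective f
  have h1 : ⟪(InnerProductSpace.toDual ℂ H).symm G, h⟫_ℂ = G h := by simp
  rw [InnerProductSpace.toDual_apply_apply, ← inner_conj_symm, h1]
  simp [G, g]

variable {E : Type*} [NormedAddCommGroup E] [NormedSpace ℂ E]

/-- The core of the Dixmier-Ng theorem: `P` is a space of functionals on `E` in which the ones
that come from the Hilbert space are dense. -/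
theorem exists_linearIsometryEquiv_dual {P : Type*} [NormedAddCommGroup P] [NormedSpace ℂ P]
    (ι : E →L[ℂ] H) (hinj : Function.Injective ι)
    (hcl : IsClosed (ι '' Metric.closedBall 0 1)) (Θ : P →ₗᵢ[ℂ] StrongDual ℂ E)
    (Φ : StrongDual ℂ H →L[ℂ] P) (hdense : DenseRange Φ)
    (hΘ : ∀ f x, Θ (Φ f) x = f (ι x)) :
    ∃ j : E ≃ₗᵢ[ℂ] StrongDual ℂ P, ∀ f x, j x (Φ f) = f (ι x) := by
  let j₀ : E →ₗ[ℂ] StrongDual ℂ P :=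
    { toFun := fun x => (NormedSpace.inclusionInDoubleDual ℂ E x).comp Θ.toContinuousLinearMap
      map_add' := fun x y => by ext p; simp
      map_smul' := fun c x => by ext p; simp }
  have hj₀ : ∀ x p, j₀ x p = Θ p x := fun x p => rfl
  have hj_le : ∀ x, ‖j₀ x‖ ≤ ‖x‖ := fun x => by
    refine ContinuousLinearMap.opNorm_le_bound _ (norm_nonneg _) fun p => ?_
    rw [hj₀, mul_comm, ← Θ.norm_map p]
    exact (Θ p).le_opNorm x
  have hj_inj : Function.Injective j₀ := by
    intro x y hxy
    apply hinj
    refine ext_inner_left ℂ fun v => ?_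
    have h1 : j₀ x (Φ (InnerProductSpace.toDual ℂ H v)) =
      j₀ y (Φ (InnerProductSpace.toDual ℂ H v)) := by rw [hxy]
    rw [hj₀, hj₀, hΘ, hΘ] at h1
    simpa using h1
  -- By reflexivity `ψ ∘ Φ` is evaluation at some `η`. A functional separating `η` from the closed
  -- convex image of the ball would contradict `‖ψ‖ ≤ 1`.
  have hball : ∀ ψ : StrongDual ℂ P, ‖ψ‖ ≤ 1 → ∃ x, ‖x‖ ≤ 1 ∧ j₀ x = ψ := by
    intro ψ hψ
    obtain ⟨η, hη⟩ := exists_eval_eq_of_bidual (ψ.comp Φ)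
    have hmem : η ∈ ι '' Metric.closedBall 0 1 := by
      by_contra hcon
      have hconv : Convex ℝ (ι '' Metric.closedBall (0 : E) 1) :=
        (convex_closedBall (0 : E) 1).linear_image ((ι : E →ₗ[ℂ] H).restrictScalars ℝ)
      obtain ⟨f, u, hfu, huf⟩ := RCLike.geometric_hahn_banach_closed_point (𝕜 := ℂ) hconv hcl hcon
      have hnorm : ∀ x : E, ‖x‖ ≤ 1 → ‖f (ι x)‖ ≤ u := by
        intro x hx
        -- Rotating `x` by a unimodular scalar turns the bound on the real part into one on the
        -- modulus.
        obtain ⟨c, hc, hcx⟩ := RCLike.exists_norm_eq_mul_self (f (ι x))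
        have h1 := hfu (ι (c • x)) ⟨c • x, by simp [norm_smul, hc, hx], rfl⟩
        have h2 : f (ι (c • x)) = (‖f (ι x)‖ : ℂ) := by
          rw [map_smul, map_smul, smul_eq_mul]; exact hcx.symm
        rw [h2] at h1
        simpa using h1.le
      have hu : 0 ≤ u := (norm_nonneg _).trans (hnorm 0 (by simp))
      have h3 : ‖Φ f‖ ≤ u := by
        rw [← Θ.norm_map]
        refine ContinuousLinearMap.opNorm_le_of_unit_norm (𝕜 := ℂ) hu fun x hx => ?_
        rw [hΘ]
        exact hnorm x hx.le
      have h4 : ‖ψ (Φ f)‖ ≤ u :=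
        (ψ.le_opNorm (Φ f)).trans <|
          (mul_le_of_le_one_left (norm_nonneg _) hψ).trans h3
      have h5 : ψ (Φ f) = f η := hη f
      rw [h5] at h4
      exact absurd ((RCLike.re_le_norm (f η)).trans h4) (not_le.2 huf)
    obtain ⟨x, hx, rfl⟩ := hmem
    refine ⟨x, by simpa using hx, ?_⟩
    refine ContinuousLinearMap.ext fun p => ?_
    exact congrFun (hdense.equalizer (j₀ x).continuous ψ.continuous
      (funext fun f => (hΘ f x).trans (hη f).symm)) p
  -- Normalising `j₀ x` and lifting it into the unit ball returns, by injectivity, the corresponding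
  -- multiple of `x`.
  have hj_norm : ∀ x, ‖j₀ x‖ = ‖x‖ := by
    intro x
    refine le_antisymm (hj_le x) ?_
    by_cases h0 : ‖j₀ x‖ = 0
    · have : x = 0 := hj_inj (by rw [norm_eq_zero.1 h0, map_zero])
      simp [this]
    · have hc : ‖((‖j₀ x‖⁻¹ : ℝ) : ℂ) • j₀ x‖ ≤ 1 := by
        rw [norm_smul, Complex.norm_real, norm_inv, norm_norm, inv_mul_cancel₀ h0]
      obtain ⟨y, hy, hyx⟩ := hball _ hc
      rw [← map_smul] at hyx
      rw [hj_inj hyx, norm_smul] at hy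
      simp only [Complex.norm_real, norm_inv, norm_norm] at hy
      have hpos : 0 < ‖j₀ x‖ := lt_of_le_of_ne (norm_nonneg _) (Ne.symm h0)
      rwa [inv_mul_le_iff₀ hpos, mul_one] at hy
  have hj_surj : Function.Surjective j₀ := by
    intro ψ
    by_cases h0 : ‖ψ‖ = 0
    · exact ⟨0, by rw [map_zero, norm_eq_zero.1 h0]⟩
    · have hc : ‖((‖ψ‖⁻¹ : ℝ) : ℂ) • ψ‖ ≤ 1 := by
        rw [norm_smul, Complex.norm_real, norm_inv, norm_norm, inv_mul_cancel₀ h0]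
      obtain ⟨y, -, hyx⟩ := hball _ hc
      refine ⟨(‖ψ‖ : ℂ) • y, ?_⟩
      rw [map_smul, hyx, smul_smul, ← Complex.ofReal_mul, mul_inv_cancel₀ h0, Complex.ofReal_one,
        one_smul]
  exact ⟨LinearIsometryEquiv.ofSurjective ⟨j₀, hj_norm⟩ hj_surj, fun f x => hΘ f x⟩

/-- A normed space that embeds continuously into a Hilbert space so that the image of the closed
unit ball is closed is the dual of a Banach space, and every functional that comes from the
Hilbert space is given by an element of that Banach space. -/
theorem exists_predual_of_isClosed_image_closedBall {E : Type u} [NormedAddCommGroup E]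
    [NormedSpace ℂ E] (ι : E →L[ℂ] H) (hinj : Function.Injective ι)
    (hcl : IsClosed (ι '' Metric.closedBall 0 1)) :
    ∃ (P : Type u) (_ : NormedAddCommGroup P) (_ : NormedSpace ℂ P) (_ : CompleteSpace P)
      (j : E ≃ₗᵢ[ℂ] StrongDual ℂ P), ∀ f : StrongDual ℂ H, ∃ p : P, ∀ x, j x p = f (ι x) := by
  obtain ⟨P, _, _, hP, Θ, Φ, hΦ, hΘ⟩ : ∃ (P : Type u) (_ : NormedAddCommGroup P)
      (_ : NormedSpace ℂ P) (_ : CompleteSpace P) (Θ : P →ₗᵢ[ℂ] StrongDual ℂ E)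
      (Φ : StrongDual ℂ H →L[ℂ] P), DenseRange Φ ∧ ∀ f x, Θ (Φ f) x = f (ι x) := by
    let Ψ : StrongDual ℂ H →L[ℂ] StrongDual ℂ E := (ContinuousLinearMap.compL ℂ E H ℂ).flip ι
    let P : Submodule ℂ (StrongDual ℂ E) :=
      (LinearMap.range (Ψ : StrongDual ℂ H →ₗ[ℂ] StrongDual ℂ E)).topologicalClosure
    have hΨ : ∀ f, Ψ f ∈ P := fun f => Submodule.le_topologicalClosure _ ⟨f, rfl⟩
    refine ⟨P, inferInstance, inferInstance,
      (Submodule.isClosed_topologicalClosure _).completeSpace_coe, P.subtypeₗᵢ,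
      Ψ.codRestrict P hΨ, fun p => ?_, fun f x => rfl⟩
    rw [Metric.mem_closure_iff]
    intro ε hε
    have hp : (p : StrongDual ℂ E) ∈
      closure (LinearMap.range (Ψ : StrongDual ℂ H →ₗ[ℂ] StrongDual ℂ E) : Set _) := p.2
    obtain ⟨_, ⟨f, rfl⟩, hf⟩ := Metric.mem_closure_iff.1 hp ε hε
    exact ⟨Ψ.codRestrict P hΨ f, ⟨f, rfl⟩, hf⟩
  obtain ⟨j, hj⟩ := exists_linearIsometryEquiv_dual ι hinj hcl Θ Φ hΦ hΘ
  exact ⟨P, inferInstance, inferInstance, hP, j, fun f => ⟨Φ f, fun x => hj f x⟩⟩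

end Predual

/-! ### The tracial von Neumann algebra generated by a tracial functional -/

/-- A dense map of a `C⋆`-algebra into a Hilbert space that implements a tracial functional. -/
structure IsTracialRep {A H : Type*} [CStarAlgebra A] [NormedAddCommGroup H]
    [InnerProductSpace ℂ H] (τ : A →ₗ[ℂ] ℂ) (v : A →ₗ[ℂ] H) : Prop where
  trace_mul_comm : ∀ a b, τ (a * b) = τ (b * a)
  dense : DenseRange v
  inner_eq : ∀ a b, ⟪v a, v b⟫_ℂ = τ (star a * b)
  norm_mul_le : ∀ a b, ‖v (a * b)‖ ≤ ‖a‖ * ‖v b‖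

/-- Right multiplication on the Hilbert space of a tracial functional. -/
noncomputable def rightMul {A H : Type*} [CStarAlgebra A] [NormedAddCommGroup H]
    [InnerProductSpace ℂ H] [CompleteSpace H] (v : A →ₗ[ℂ] H) (a : A) : H →L[ℂ] H :=
  (v ∘ₗ LinearMap.mulRight ℂ a).extendOfNorm v

/-- The commutant of the right multiplications. -/
noncomputable def rightCommutant {A H : Type*} [CStarAlgebra A] [NormedAddCommGroup H]
    [InnerProductSpace ℂ H] [CompleteSpace H] (v : A →ₗ[ℂ] H) : StarSubalgebra ℂ (H →L[ℂ] H) :=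
  StarSubalgebra.centralizer ℂ (Set.range (rightMul v))

theorem isClosed_rightCommutant {A H : Type*} [CStarAlgebra A] [NormedAddCommGroup H]
    [InnerProductSpace ℂ H] [CompleteSpace H] (v : A →ₗ[ℂ] H) :
    IsClosed (rightCommutant v : Set (H →L[ℂ] H)) :=
  Set.isClosed_centralizer _

namespace IsTracialRep

variable {A H : Type*} [CStarAlgebra A] [NormedAddCommGroup H] [InnerProductSpace ℂ H]
  {τ : A →ₗ[ℂ] ℂ} {v : A →ₗ[ℂ] H} (h : IsTracialRep τ v)
include h

theorem norm_star (a : A) : ‖v (star a)‖ = ‖v a‖ := by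
  rw [← sq_eq_sq₀ (norm_nonneg _) (norm_nonneg _), ← inner_self_eq_norm_sq (𝕜 := ℂ),
    ← inner_self_eq_norm_sq (𝕜 := ℂ), h.inner_eq, h.inner_eq, h.trace_mul_comm]
  simp

/-- Traciality makes the adjoint isometric, which exchanges left and right multiplication. -/
theorem norm_mul_le' (a b : A) : ‖v (a * b)‖ ≤ ‖b‖ * ‖v a‖ := by
  rw [← h.norm_star, star_mul, ← h.norm_star a, ← _root_.norm_star b]
  exact h.norm_mul_le _ _

theorem ext_dense {E : Type*} [TopologicalSpace E] [T2Space E] {f g : H → E} (hf : Continuous f)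
    (hg : Continuous g) (hfg : ∀ a, f (v a) = g (v a)) (x : H) : f x = g x :=
  congrFun (h.dense.equalizer hf hg (funext hfg)) x

variable [CompleteSpace H]

theorem rightMul_apply (a b : A) : rightMul v a (v b) = v (b * a) :=
  LinearMap.extendOfNorm_eq h.dense ⟨‖a‖, fun x => h.norm_mul_le' x a⟩ b

theorem rightMul_add (a b : A) (x : H) : rightMul v (a + b) x = rightMul v a x + rightMul v b x :=
  h.ext_dense (f := fun x => rightMul v (a + b) x)
    (g := fun x => rightMul v a x + rightMul v b x) (by fun_prop) (by fun_prop)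
    (fun c => by simp only [h.rightMul_apply, mul_add, map_add]) x

theorem rightMul_smul (c : ℂ) (a : A) (x : H) : rightMul v (c • a) x = c • rightMul v a x :=
  h.ext_dense (f := fun x => rightMul v (c • a) x)
    (g := fun x => c • rightMul v a x) (by fun_prop) (by fun_prop)
    (fun c => by simp only [h.rightMul_apply, mul_smul_comm, map_smul]) x

theorem rightMul_mul (a b : A) (x : H) : rightMul v (a * b) x = rightMul v b (rightMul v a x) :=
  h.ext_dense (f := fun x => rightMul v (a * b) x)
    (g := fun x => rightMul v b (rightMul v a x)) (by fun_prop) (by fun_prop)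
    (fun c => by simp only [h.rightMul_apply, mul_assoc]) x

theorem rightMul_one (x : H) : rightMul v 1 x = x :=
  h.ext_dense (f := fun x => rightMul v 1 x) (g := fun x => x) (by fun_prop) (by fun_prop)
    (fun c => by simp only [h.rightMul_apply, mul_one]) x

theorem adjoint_rightMul (a : A) :
    ContinuousLinearMap.adjoint (rightMul v a) = rightMul v (star a) := by
  symm
  rw [ContinuousLinearMap.eq_adjoint_iff]
  intro x y
  refine h.ext_dense (f := fun x => ⟪rightMul v (star a) x, y⟫_ℂ)
    (g := fun x => ⟪x, rightMul v a y⟫_ℂ) (by fun_prop) (by fun_prop) (fun b => ?_) x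
  refine h.ext_dense (f := fun y => ⟪rightMul v (star a) (v b), y⟫_ℂ)
    (g := fun y => ⟪v b, rightMul v a y⟫_ℂ) (by fun_prop) (by fun_prop) (fun c => ?_) y
  simp only [h.rightMul_apply, h.inner_eq, star_mul, star_star]
  rw [mul_assoc, h.trace_mul_comm, mul_assoc]

/-- Right multiplications are closed under adjoints, so the centralizer's condition on adjoints is
automatic, and commutation need only be tested on the dense range of `v`. -/
theorem mem_rightCommutant {T : H →L[ℂ] H} :
    T ∈ rightCommutant v ↔ ∀ a b, T (v (b * a)) = rightMul v a (T (v b)) := by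
  rw [rightCommutant, StarSubalgebra.mem_centralizer_iff]
  constructor
  · intro hT a b
    rw [← h.rightMul_apply]
    exact (congrArg (fun S : H →L[ℂ] H => S (v b)) (hT _ ⟨a, rfl⟩).1).symm
  · rintro hT _ ⟨a, rfl⟩
    have key : ∀ a, rightMul v a * T = T * rightMul v a := by
      intro a
      refine ContinuousLinearMap.ext fun x => ?_
      refine h.ext_dense (f := fun x => rightMul v a (T x)) (g := fun x => T (rightMul v a x))
        (by fun_prop) (by fun_prop) (fun b => ?_) x
      simp only [h.rightMul_apply, hT]
    refine ⟨key a, ?_⟩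
    rw [ContinuousLinearMap.star_eq_adjoint, h.adjoint_rightMul]
    exact key _

theorem apply_eq {T : H →L[ℂ] H} (hT : T ∈ rightCommutant v) (a : A) :
    T (v a) = rightMul v a (T (v 1)) := by
  rw [← h.mem_rightCommutant.1 hT, one_mul]

/-- The vectors that are images of the cyclic vector under contractions in the commutant. -/
theorem exists_apply_eq_iff (ξ : H) :
    (∃ T ∈ rightCommutant v, ‖T‖ ≤ 1 ∧ T (v 1) = ξ) ↔ ∀ a, ‖rightMul v a ξ‖ ≤ ‖v a‖ := by
  constructor
  · rintro ⟨T, hT, hT1, rfl⟩ a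
    rw [← h.apply_eq hT]
    exact (T.le_opNorm _).trans (mul_le_of_le_one_left (norm_nonneg _) hT1)
  · intro hξ
    let g : A →ₗ[ℂ] H :=
      { toFun := fun a => rightMul v a ξ
        map_add' := fun a b => h.rightMul_add a b ξ
        map_smul' := fun c a => h.rightMul_smul c a ξ }
    have hg : ∀ a, ‖g a‖ ≤ 1 * ‖v a‖ := fun a => by rw [one_mul]; exact hξ a
    have hT : ∀ a, g.extendOfNorm v (v a) = rightMul v a ξ :=
      fun a => LinearMap.extendOfNorm_eq h.dense ⟨1, hg⟩ a
    refine ⟨g.extendOfNorm v, ?_, LinearMap.opNorm_extendOfNorm_le h.dense zero_le_one hg, ?_⟩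
    · rw [h.mem_rightCommutant]
      intro a b
      rw [hT, hT, h.rightMul_mul]
    · rw [hT, h.rightMul_one]

/-- The image is cut out by the bounds of `exists_apply_eq_iff`, one closed condition for each `a`.
This is what the construction of the predual needs. -/
theorem isClosed_image_closedBall :
    IsClosed ((fun T : rightCommutant v => (T : H →L[ℂ] H) (v 1)) '' Metric.closedBall 0 1) := by
  have : ((fun T : rightCommutant v => (T : H →L[ℂ] H) (v 1)) '' Metric.closedBall 0 1) =
      ⋂ a, {ξ | ‖rightMul v a ξ‖ ≤ ‖v a‖} := by
    ext ξ
    rw [Set.mem_iInter]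
    refine Iff.trans ?_ (h.exists_apply_eq_iff ξ)
    constructor
    · rintro ⟨T, hT, rfl⟩
      exact ⟨T, T.2, by simpa using hT, rfl⟩
    · rintro ⟨T, hT, hT1, rfl⟩
      exact ⟨⟨T, hT⟩, by simpa using hT1, rfl⟩
  rw [this]
  exact isClosed_iInter fun a => isClosed_le (by fun_prop) continuous_const

/-- The modular conjugation. -/
theorem exists_conjugation :
    ∃ J : H → H, (∀ a, J (v a) = v (star a)) ∧ (∀ x y, ⟪J x, J y⟫_ℂ = ⟪y, x⟫_ℂ) := by
  let g : A →ₗ⋆[ℂ] H :=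
    { toFun := fun a => v (star a)
      map_add' := fun a b => by simp
      map_smul' := fun c a => by rw [star_smul, map_smul]; rfl }
  have hJ : ∀ a, g.extendOfNorm v (v a) = v (star a) := fun a =>
    LinearMap.extendOfNorm_eq h.dense ⟨1, fun a => by rw [one_mul]; exact (h.norm_star a).le⟩ a
  refine ⟨g.extendOfNorm v, hJ, fun x y => ?_⟩
  refine h.ext_dense (f := fun x => ⟪g.extendOfNorm v x, g.extendOfNorm v y⟫_ℂ)
    (g := fun x => ⟪y, x⟫_ℂ) (by fun_prop) (by fun_prop) (fun b => ?_) x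
  refine h.ext_dense (f := fun y => ⟪g.extendOfNorm v (v b), g.extendOfNorm v y⟫_ℂ)
    (g := fun y => ⟪y, v b⟫_ℂ) (by fun_prop) (by fun_prop) (fun c => ?_) y
  simp only [hJ, h.inner_eq, star_star]
  rw [h.trace_mul_comm]

/-- The conjugation `J` sends `T (v 1)` to `T⋆ (v 1)` for every `T` in the commutant. Moving `S` to
the left of the inner product, applying `J` to both entries and moving `T⋆` back gives traciality.
-/
theorem inner_mul_comm {S T : H →L[ℂ] H} (hS : S ∈ rightCommutant v) (hT : T ∈ rightCommutant v) :
    ⟪v 1, S (T (v 1))⟫_ℂ = ⟪v 1, T (S (v 1))⟫_ℂ := by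
  obtain ⟨J, hJ, hJJ⟩ := h.exists_conjugation
  have hstar : ∀ T ∈ rightCommutant v, ContinuousLinearMap.adjoint T (v 1) = J (T (v 1)) := by
    intro T hT
    refine ext_inner_left ℂ fun x => ?_
    refine h.ext_dense (f := fun x => ⟪x, ContinuousLinearMap.adjoint T (v 1)⟫_ℂ)
      (g := fun x => ⟪x, J (T (v 1))⟫_ℂ) (by fun_prop) (by fun_prop) (fun b => ?_) x
    have h1 : v b = J (v (star b)) := by rw [hJ, star_star]
    simp only [ContinuousLinearMap.adjoint_inner_right]
    rw [h1, hJJ, ← h1, h.apply_eq hT, ← ContinuousLinearMap.adjoint_inner_right,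
      h.adjoint_rightMul, h.rightMul_apply, one_mul]
  have hadj : ∀ T ∈ rightCommutant v, ContinuousLinearMap.adjoint T ∈ rightCommutant v :=
    fun T hT => (rightCommutant v).star_mem' hT
  have hT' := hstar _ (hadj T hT)
  rw [ContinuousLinearMap.adjoint_adjoint] at hT'
  rw [← ContinuousLinearMap.adjoint_inner_left, hstar S hS, hT', hJJ,
    ContinuousLinearMap.adjoint_inner_left]

theorem eq_zero_of_apply_eq_zero {T : H →L[ℂ] H} (hT : T ∈ rightCommutant v) (h0 : T (v 1) = 0) :
    T = 0 := by
  refine ContinuousLinearMap.ext fun x => ?_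
  refine h.ext_dense (f := fun x => T x) (g := fun _ => (0 : H)) (by fun_prop) (by fun_prop)
    (fun a => ?_) x
  rw [h.apply_eq hT, h0, map_zero]

end IsTracialRep

/-- The GNS construction for a tracial functional. -/
theorem exists_isTracialRep {A : Type u} [CStarAlgebra A] (τ : A →ₗ[ℂ] ℂ)
    (hpos : ∀ x, 0 ≤ (τ (star x * x)).re ∧ (τ (star x * x)).im = 0)
    (htr : ∀ x y, τ (x * y) = τ (y * x)) :
    ∃ (H : Type u) (_ : NormedAddCommGroup H) (_ : InnerProductSpace ℂ H) (_ : CompleteSpace H)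
      (v : A →ₗ[ℂ] H) (l : A →⋆ₐ[ℂ] (H →L[ℂ] H)), IsTracialRep τ v ∧
        ∀ a b, l a (v b) = v (a * b) := by
  let _ : PartialOrder A := CStarAlgebra.spectralOrder A
  have : StarOrderedRing A := CStarAlgebra.spectralOrderedRing A
  open scoped ComplexOrder in
  let f : A →ₚ[ℂ] ℂ := PositiveLinearMap.mk₀ τ fun x hx => by
    obtain ⟨y, rfl⟩ := CStarAlgebra.nonneg_iff_eq_star_mul_self.1 hx
    exact Complex.nonneg_iff.2 ⟨(hpos y).1, (hpos y).2.symm⟩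
  let v : A →ₗ[ℂ] f.GNS :=
    (UniformSpace.Completion.toComplL (𝕜 := ℂ) (E := f.PreGNS)).toLinearMap ∘ₗ
      f.toPreGNS.toLinearMap
  have hl : ∀ a b, f.gnsStarAlgHom a (v b) = v (a * b) := fun a b => by
    change f.gnsNonUnitalStarAlgHom a _ = _
    exact f.gnsNonUnitalStarAlgHom_apply_coe
  refine ⟨f.GNS, inferInstance, inferInstance, inferInstance, v, f.gnsStarAlgHom,
    ⟨htr, ?_, ?_, ?_⟩, hl⟩
  · exact UniformSpace.Completion.denseRange_coe.comp f.toPreGNS.surjective.denseRange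
      (UniformSpace.Completion.continuous_coe _)
  · intro a b
    exact UniformSpace.Completion.inner_coe _ _
  · intro a b
    rw [← hl]
    refine (ContinuousLinearMap.le_opNorm _ _).trans ?_
    gcongr
    exact NonUnitalStarAlgHom.norm_apply_le f.gnsStarAlgHom a

/-- A `C⋆`-algebra with a tracial state that is given by an embedding into a Hilbert space such
that the image of the closed unit ball is closed is a tracial `W⋆`-algebra. -/
theorem exists_equiv_tracialWStarAlgebra {N : Type u} [CStarAlgebra N] {H : Type*}
    [NormedAddCommGroup H] [InnerProductSpace ℂ H] [CompleteSpace H] (ι : N →L[ℂ] H)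
    (hinj : Function.Injective ι) (hcl : IsClosed (ι '' Metric.closedBall 0 1))
    (hone : ⟪ι 1, ι 1⟫_ℂ = 1)
    (hstar : ∀ S T, ⟪ι 1, ι (star S * T)⟫_ℂ = ⟪ι S, ι T⟫_ℂ)
    (hcomm : ∀ S T, ⟪ι 1, ι (S * T)⟫_ℂ = ⟪ι 1, ι (T * S)⟫_ℂ) :
    ∃ (M : TracialWStarAlgebra.{u}) (e : N ≃⋆ₐ[ℂ] M), (∀ S, M.tr (e S) = ⟪ι 1, ι S⟫_ℂ) ∧
      ∀ S T, M.d (e S) (e T) = ‖ι S - ι T‖ := by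
  let t : N →ₗ[ℂ] ℂ := (innerSL ℂ (ι 1)).toLinearMap ∘ₗ ι.toLinearMap
  have ht : ∀ T : N, t T = ⟪ι 1, ι T⟫_ℂ := fun T => rfl
  have htt : ∀ T : N, t (star T * T) = ((‖ι T‖ ^ 2 : ℝ) : ℂ) := by
    intro T
    rw [ht, hstar, inner_self_eq_norm_sq_to_K]
    norm_cast
  have htstar : ∀ T : N, t (star T) = conj (t T) := by
    intro T
    rw [ht, ht, inner_conj_symm, ← hstar T 1, mul_one]
  obtain ⟨P, _, _, hP, j, hj⟩ := exists_predual_of_isClosed_image_closedBall ι hinj hcl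
  -- The identification with a dual has to be conjugate-linear, whereas `j` is linear; composing
  -- with the adjoint repairs this and only conjugates the trace.
  let e : StrongDual ℂ P ≃ₗᵢ⋆[ℂ] N := j.symm.trans (starₗᵢ ℂ)
  have : WStarAlgebra N := ⟨⟨P, inferInstance, inferInstance, hP, ⟨e⟩⟩⟩
  have hnormal : IsWeakStarContinuous t := by
    refine ⟨P, inferInstance, inferInstance, hP, e, ?_⟩
    obtain ⟨p, hp⟩ := hj (innerSL ℂ (ι 1))
    have : ∀ φ : WeakDual ℂ P, t (e (WeakDual.toStrongDual φ)) = conj (φ p) := by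
      intro φ
      obtain ⟨T, hT⟩ := j.surjective (WeakDual.toStrongDual φ)
      have h1 : e (WeakDual.toStrongDual φ) = star T := by
        rw [← hT]
        simp [e]
      have h2 : φ p = t T := (congrArg (fun ψ : StrongDual ℂ P => ψ p) hT).symm.trans (hp T)
      rw [h1, h2, htstar]
    simp only [this]
    exact Complex.continuous_conj.comp (WeakDual.eval_continuous p)
  refine ⟨{ carrier := N
            tr := t
            tr_star_mul_self := fun T => by
              rw [htt]
              exact ⟨by rw [Complex.ofReal_re]; positivity, Complex.ofReal_im _⟩
            tr_one := hone
            tr_mul_comm := hcomm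
            tr_faithful := fun T hT => by
              rw [htt] at hT
              apply hinj
              rw [map_zero, ← norm_eq_zero]
              exact pow_eq_zero_iff two_ne_zero |>.1 (Complex.ofReal_eq_zero.1 hT)
            tr_normal := hnormal },
    StarAlgEquiv.refl ℂ N, fun S => rfl, fun S T => ?_⟩
  change Real.sqrt (t (star (S - T) * (S - T))).re = _
  rw [htt, Complex.ofReal_re, Real.sqrt_sq (norm_nonneg _), map_sub]

/-- A tracial state on a `C⋆`-algebra extends to a tracial `W⋆`-algebra in which the `C⋆`-algebra
is dense for the metric of the trace. -/
theorem exists_tracialWStarAlgebra {A : Type u} [CStarAlgebra A] (τ : A →ₗ[ℂ] ℂ)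
    (hpos : ∀ x, 0 ≤ (τ (star x * x)).re ∧ (τ (star x * x)).im = 0)
    (hone : τ 1 = 1) (htr : ∀ x y, τ (x * y) = τ (y * x)) :
    ∃ (N : TracialWStarAlgebra.{u}) (π : A →⋆ₐ[ℂ] N), (∀ a, N.tr (π a) = τ a) ∧
      ∀ (y : N) (ε : ℝ), 0 < ε → ∃ a, N.d y (π a) < ε := by
  obtain ⟨H, _, _, _, v, l, h, hl⟩ := exists_isTracialRep τ hpos htr
  have hcl : IsClosed (rightCommutant v : Set (H →L[ℂ] H)) := isClosed_rightCommutant v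
  let ι : rightCommutant v →L[ℂ] H := (ContinuousLinearMap.apply ℂ H (v 1)).comp
    ((rightCommutant v).toSubalgebra.toSubmodule.subtypeL)
  have hι : ∀ T : rightCommutant v, ι T = (T : H →L[ℂ] H) (v 1) := fun T => rfl
  have hι1 : ι 1 = v 1 := rfl
  have hinj : Function.Injective ι := by
    rw [injective_iff_map_eq_zero]
    intro T hT
    exact Subtype.ext (h.eq_zero_of_apply_eq_zero T.2 hT)
  have hlmem : ∀ a, l a ∈ rightCommutant v := by
    intro a
    rw [h.mem_rightCommutant]
    intro b c
    rw [hl, hl, h.rightMul_apply, mul_assoc]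
  have hπ : ∀ a, ι (l.codRestrict (rightCommutant v) hlmem a) = v a := fun a => by
    change l a (v 1) = v a
    rw [hl, mul_one]
  obtain ⟨M, e, he, hd⟩ := exists_equiv_tracialWStarAlgebra ι hinj h.isClosed_image_closedBall
    (by rw [hι1, h.inner_eq, star_one, one_mul, hone])
    (fun S T => ContinuousLinearMap.adjoint_inner_right _ _ _)
    (fun S T => h.inner_mul_comm S.2 T.2)
  refine ⟨M, (e : rightCommutant v →⋆ₐ[ℂ] M).comp (l.codRestrict (rightCommutant v) hlmem),
    fun a => ?_, fun y ε hε => ?_⟩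
  · refine (he _).trans ((congrArg (fun z => ⟪ι 1, z⟫_ℂ) (hπ a)).trans ?_)
    rw [hι1, h.inner_eq, star_one, one_mul]
  -- The metric is the Hilbert norm of `ι`, so density of `v` in all of `H` suffices, with no appeal
  -- to the double commutant theorem.
  · obtain ⟨y, rfl⟩ := e.surjective y
    obtain ⟨_, ⟨a, rfl⟩, ha⟩ := Metric.mem_closure_iff.1 (h.dense (ι y)) ε hε
    refine ⟨a, (hd _ _).trans_lt ((congrArg (fun z => ‖ι y - z‖) (hπ a)).trans_lt ?_)⟩
    rwa [← dist_eq_norm]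

/-! ### The metric of the trace -/

namespace TracialWStarAlgebra

variable (M : TracialWStarAlgebra.{u})

instance : Nontrivial M :=
  ⟨1, 0, fun h => by simpa [h] using M.tr_one⟩

/-- In this representation, properties of the metric become inequalities between Hilbert norms. -/
theorem exists_rep : ∃ (H : Type u) (_ : NormedAddCommGroup H) (_ : InnerProductSpace ℂ H)
    (v : M →ₗ[ℂ] H), IsTracialRep M.tr v ∧ (∀ x y, M.d x y = ‖v x - v y‖) ∧ ‖v 1‖ = 1 := by
  obtain ⟨H, _, _, _, v, l, h, -⟩ :=
    exists_isTracialRep M.tr M.tr_star_mul_self M.tr_mul_comm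
  have hnorm : ∀ x, ‖v x‖ = Real.sqrt (M.tr (star x * x)).re := fun x => by
    rw [← h.inner_eq, norm_eq_sqrt_re_inner (𝕜 := ℂ)]
    rfl
  refine ⟨H, inferInstance, inferInstance, v, h, fun x y => ?_, ?_⟩
  · rw [← map_sub, hnorm]
    rfl
  · rw [hnorm, star_one, one_mul, M.tr_one]
    simp

variable {M}

theorem d_nonneg (x y : M) : 0 ≤ M.d x y := Real.sqrt_nonneg _

theorem d_self (x : M) : M.d x x = 0 := by
  obtain ⟨H, _, _, v, h, hd, -⟩ := M.exists_rep
  rw [hd, sub_self, norm_zero]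

theorem d_comm (x y : M) : M.d x y = M.d y x := by
  obtain ⟨H, _, _, v, h, hd, -⟩ := M.exists_rep
  rw [hd, hd, norm_sub_rev]

theorem d_triangle (x y z : M) : M.d x z ≤ M.d x y + M.d y z := by
  obtain ⟨H, _, _, v, h, hd, -⟩ := M.exists_rep
  rw [hd, hd, hd]
  exact norm_sub_le_norm_sub_add_norm_sub _ _ _

theorem abs_d_sub_d_le (x y x' y' : M) : |M.d x y - M.d x' y'| ≤ M.d x x' + M.d y y' := by
  have h1 := d_triangle x x' y
  have h2 := d_triangle x' y' y
  have h3 := d_triangle x' x y'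
  have h4 := d_triangle x y y'
  rw [d_comm y' y] at h2
  rw [d_comm x' x] at h3
  rw [abs_le]
  constructor <;> linarith

theorem d_add_le (x y x' y' : M) : M.d (x + y) (x' + y') ≤ M.d x x' + M.d y y' := by
  obtain ⟨H, _, _, v, h, hd, -⟩ := M.exists_rep
  rw [hd, hd, hd, map_add, map_add, add_sub_add_comm]
  exact norm_add_le _ _

theorem d_smul (c : ℂ) (x y : M) : M.d (c • x) (c • y) = ‖c‖ * M.d x y := by
  obtain ⟨H, _, _, v, h, hd, -⟩ := M.exists_rep
  rw [hd, hd, map_smul, map_smul, ← smul_sub, norm_smul]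

theorem d_star (x y : M) : M.d (star x) (star y) = M.d x y := by
  obtain ⟨H, _, _, v, h, hd, -⟩ := M.exists_rep
  rw [hd, hd, ← map_sub, ← map_sub, ← star_sub, h.norm_star]

theorem d_mul_left_le (a x y : M) : M.d (a * x) (a * y) ≤ ‖a‖ * M.d x y := by
  obtain ⟨H, _, _, v, h, hd, -⟩ := M.exists_rep
  rw [hd, hd, ← map_sub, ← map_sub, ← mul_sub]
  exact h.norm_mul_le _ _

theorem d_mul_right_le (a x y : M) : M.d (x * a) (y * a) ≤ ‖a‖ * M.d x y := by
  obtain ⟨H, _, _, v, h, hd, -⟩ := M.exists_rep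
  rw [hd, hd, ← map_sub, ← map_sub, ← sub_mul]
  exact h.norm_mul_le' _ _

theorem d_mul_le (x y x' y' : M) : M.d (x * y) (x' * y') ≤ ‖y‖ * M.d x x' + ‖x'‖ * M.d y y' :=
  (d_triangle _ (x' * y) _).trans (add_le_add (d_mul_right_le _ _ _) (d_mul_left_le _ _ _))

theorem norm_tr_sub_tr_le (x y : M) : ‖M.tr x - M.tr y‖ ≤ M.d x y := by
  obtain ⟨H, _, _, v, h, hd, h1⟩ := M.exists_rep
  have : M.tr x - M.tr y = ⟪v 1, v x - v y⟫_ℂ := by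
    rw [← map_sub, ← map_sub, h.inner_eq, star_one, one_mul]
  rw [this, hd]
  exact (norm_inner_le_norm _ _).trans (by rw [h1, one_mul])

theorem d_le_norm_sub (x y : M) : M.d x y ≤ ‖x - y‖ := by
  obtain ⟨H, _, _, v, h, hd, h1⟩ := M.exists_rep
  have := h.norm_mul_le (x - y) 1
  rwa [mul_one, h1, mul_one, map_sub, ← hd] at this

theorem norm_tr_le (x : M) : ‖M.tr x‖ ≤ ‖x‖ := by
  have := (norm_tr_sub_tr_le x 0).trans (d_le_norm_sub x 0)
  simpa using this

/-- Only the indices of positive weight are constrained, as in a partition of unity. Some weight is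
positive, so the inequality stays strict. -/
theorem d_sum_smul_le {κ : Type*} [Fintype κ] (c : κ → ℝ) (hc : ∀ j, 0 ≤ c j)
    (hsum : ∑ j, c j = 1) (x : M) (y : κ → M) {ε : ℝ} (hy : ∀ j, 0 < c j → M.d x (y j) < ε) :
    M.d x (∑ j, (c j : ℂ) • y j) < ε := by
  obtain ⟨H, _, _, v, h, hd, -⟩ := M.exists_rep
  simp only [hd] at hy ⊢
  have h1 : v x - v (∑ j, (c j : ℂ) • y j) = ∑ j, (c j : ℂ) • (v x - v (y j)) := by
    simp only [smul_sub, Finset.sum_sub_distrib, ← Finset.sum_smul, map_sum, map_smul]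
    rw [← Complex.ofReal_sum, hsum, Complex.ofReal_one, one_smul]
  rw [h1]
  have hterm : ∀ j, ‖(c j : ℂ) • (v x - v (y j))‖ ≤ c j * ε := fun j => by
    rw [norm_smul, Complex.norm_real, Real.norm_of_nonneg (hc j)]
    rcases (hc j).eq_or_lt with h0 | h0
    · rw [← h0, zero_mul, zero_mul]
    · exact mul_le_mul_of_nonneg_left (hy j h0).le h0.le
  obtain ⟨i, hi⟩ : ∃ i, 0 < c i := by
    by_contra! hcon
    have : ∑ j, c j ≤ 0 := Finset.sum_nonpos fun j _ => hcon j
    linarith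
  calc ‖∑ j, (c j : ℂ) • (v x - v (y j))‖ ≤ ∑ j, ‖(c j : ℂ) • (v x - v (y j))‖ :=
        norm_sum_le _ _
    _ < ∑ j, c j * ε := by
        refine Finset.sum_lt_sum (fun j _ => hterm j) ⟨i, Finset.mem_univ i, ?_⟩
        rw [norm_smul, Complex.norm_real, Real.norm_of_nonneg (hc i)]
        exact mul_lt_mul_of_pos_left (hy i hi) hi
    _ = ε := by rw [← Finset.sum_mul, hsum, one_mul]

end TracialWStarAlgebra

open TracialWStarAlgebra

/-! ### Evaluation and substitution of terms -/

/-- The interpretation of a term in a `⋆`-algebra. -/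
noncomputable def Term.aeval {ι : Type} {B : Type*} [Ring B] [Algebra ℂ B] [Star B] (X : ι → B) :
    Term ι → B
  | .var i => X i
  | .zero => 0
  | .one => 1
  | .add s t => s.aeval X + t.aeval X
  | .mul s t => s.aeval X * t.aeval X
  | .star t => Star.star (t.aeval X)
  | .smul c t => c • t.aeval X
  | .poly _ p t => FreeAlgebra.lift ℂ (fun i => (t i).aeval X) p

theorem Term.eval_eq_aeval {ι : Type} {M : TracialWStarAlgebra.{u}} (X : ι → M) (t : Term ι) :
    t.eval M X = t.aeval X := by
  induction t with
  | var i => rfl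
  | zero => rfl
  | one => rfl
  | add s t hs ht => simp only [Term.eval, Term.aeval, hs, ht]
  | mul s t hs ht => simp only [Term.eval, Term.aeval, hs, ht]
  | star t ht => simp only [Term.eval, Term.aeval, ht]
  | smul c t ht => simp only [Term.eval, Term.aeval, ht]
  | poly n p t ht => simp only [Term.eval, Term.aeval, ht]

theorem Term.map_aeval {ι : Type} {B C : Type*} [Ring B] [Algebra ℂ B] [Star B] [Ring C]
    [Algebra ℂ C] [Star C] (π : B →⋆ₐ[ℂ] C) (X : ι → B) (t : Term ι) :
    π (t.aeval X) = t.aeval (fun i => π (X i)) := by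
  induction t with
  | var i => rfl
  | zero => exact map_zero π
  | one => exact map_one π
  | add s t hs ht => simp only [Term.aeval, map_add, hs, ht]
  | mul s t hs ht => simp only [Term.aeval, map_mul, hs, ht]
  | star t ht => simp only [Term.aeval, map_star, ht]
  | smul c t ht => simp only [Term.aeval, map_smul, ht]
  | poly n p t ht =>
    simp only [Term.aeval]
    have : (π : B →ₐ[ℂ] C).comp (FreeAlgebra.lift ℂ fun i => (t i).aeval X) =
        FreeAlgebra.lift ℂ fun i => (t i).aeval (fun i => π (X i)) := by
      ext i
      simpa using ht i
    exact congrArg (fun φ : FreeAlgebra ℂ (Fin n) →ₐ[ℂ] C => φ p) this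

/-- Substitution of terms for variables in a term. -/
def Term.bind {ι κ : Type} (s : ι → Term κ) : Term ι → Term κ
  | .var i => s i
  | .zero => .zero
  | .one => .one
  | .add t t' => .add (t.bind s) (t'.bind s)
  | .mul t t' => .mul (t.bind s) (t'.bind s)
  | .star t => .star (t.bind s)
  | .smul c t => .smul c (t.bind s)
  | .poly n p t => .poly n p (fun i => (t i).bind s)

theorem Term.eval_bind {ι κ : Type} (s : ι → Term κ) (M : TracialWStarAlgebra.{u}) (X : κ → M)
    (t : Term ι) : (t.bind s).eval M X = t.eval M (fun i => (s i).eval M X) := by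
  induction t with
  | var i => rfl
  | zero => rfl
  | one => rfl
  | add s t hs ht => simp only [Term.eval, Term.bind, hs, ht]
  | mul s t hs ht => simp only [Term.eval, Term.bind, hs, ht]
  | star t ht => simp only [Term.eval, Term.bind, ht]
  | smul c t ht => simp only [Term.eval, Term.bind, ht]
  | poly n p t ht => simp only [Term.eval, Term.bind, ht]

/-- Substitution of terms for variables in a formula. -/
def QFFormula.bind {ι κ : Type} (s : ι → Term κ) : QFFormula ι → QFFormula κ
  | .d t t' => .d (t.bind s) (t'.bind s)
  | .reTr t => .reTr (t.bind s)
  | .imTr t => .imTr (t.bind s)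
  | .conn n F φ => .conn n F (fun i => (φ i).bind s)

theorem QFFormula.eval_bind {ι κ : Type} (s : ι → Term κ) (M : TracialWStarAlgebra.{u})
    (X : κ → M) (φ : QFFormula ι) :
    (φ.bind s).eval M X = φ.eval M (fun i => (s i).eval M X) := by
  induction φ with
  | d t t' => simp only [QFFormula.eval, QFFormula.bind, Term.eval_bind]
  | reTr t => simp only [QFFormula.eval, QFFormula.bind, Term.eval_bind]
  | imTr t => simp only [QFFormula.eval, QFFormula.bind, Term.eval_bind]
  | conn n F φ h => simp only [QFFormula.eval, QFFormula.bind, h]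

/-! ### Boundedness and uniform continuity on products of domains -/

/-- A family of functions that is bounded and Lipschitz on a product of domains, uniformly over all
tracial `W⋆`-algebras. -/
structure IsBoundedLipschitz {ι : Type} (r : ι → ℝ)
    (h : (M : TracialWStarAlgebra.{u}) → (ι → M) → M) : Prop where
  bounded : ∃ C : ℝ, 0 ≤ C ∧ ∀ (M : TracialWStarAlgebra.{u}) (X : ι → M),
    (∀ i, X i ∈ M.D (r i)) → ‖h M X‖ ≤ C
  lipschitz : ∃ L : ℝ, 0 ≤ L ∧ ∀ (M : TracialWStarAlgebra.{u}) (X Y : ι → M) (δ : ℝ),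
    (∀ i, X i ∈ M.D (r i)) → (∀ i, Y i ∈ M.D (r i)) → 0 ≤ δ →
    (∀ i, M.d (X i) (Y i) ≤ δ) → M.d (h M X) (h M Y) ≤ L * δ

namespace IsBoundedLipschitz

variable {ι : Type} {r : ι → ℝ} {g h : (M : TracialWStarAlgebra.{u}) → (ι → M) → M}

theorem var (i : ι) : IsBoundedLipschitz.{u} r (fun _ X => X i) :=
  ⟨⟨|r i|, abs_nonneg _, fun M X hX => (hX i).trans (le_abs_self _)⟩,
    ⟨1, zero_le_one, fun M X Y δ _ _ _ h => by rw [one_mul]; exact h i⟩⟩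

theorem const (c : ℂ) :
    IsBoundedLipschitz.{u} r (fun M _ => algebraMap ℂ M c) :=
  ⟨⟨‖c‖, norm_nonneg _, fun M X _ => by rw [norm_algebraMap']⟩,
    ⟨0, le_rfl, fun M X Y δ _ _ _ _ => by rw [d_self, zero_mul]⟩⟩

theorem add (hg : IsBoundedLipschitz r g) (hh : IsBoundedLipschitz r h) :
    IsBoundedLipschitz r (fun M X => g M X + h M X) := by
  obtain ⟨⟨C, hC, hgC⟩, ⟨L, hL, hgL⟩⟩ := hg
  obtain ⟨⟨C', hC', hhC⟩, ⟨L', hL', hhL⟩⟩ := hh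
  refine ⟨⟨C + C', by positivity, fun M X hX => (norm_add_le _ _).trans
    (add_le_add (hgC M X hX) (hhC M X hX))⟩, ⟨L + L', by positivity,
    fun M X Y δ hX hY hδ hXY => ?_⟩⟩
  rw [add_mul]
  exact (d_add_le _ _ _ _).trans (add_le_add (hgL M X Y δ hX hY hδ hXY) (hhL M X Y δ hX hY hδ hXY))

theorem mul (hg : IsBoundedLipschitz r g) (hh : IsBoundedLipschitz r h) :
    IsBoundedLipschitz r (fun M X => g M X * h M X) := by
  obtain ⟨⟨C, hC, hgC⟩, ⟨L, hL, hgL⟩⟩ := hg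
  obtain ⟨⟨C', hC', hhC⟩, ⟨L', hL', hhL⟩⟩ := hh
  refine ⟨⟨C * C', by positivity, fun M X hX => (norm_mul_le _ _).trans
    (mul_le_mul (hgC M X hX) (hhC M X hX) (norm_nonneg _) hC)⟩, ⟨C' * L + C * L', by positivity,
    fun M X Y δ hX hY hδ hXY => ?_⟩⟩
  rw [add_mul, mul_assoc, mul_assoc]
  exact (d_mul_le _ _ _ _).trans (add_le_add
    (mul_le_mul (hhC M X hX) (hgL M X Y δ hX hY hδ hXY) (d_nonneg _ _) hC')
    (mul_le_mul (hgC M Y hY) (hhL M X Y δ hX hY hδ hXY) (d_nonneg _ _) hC))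

theorem star (hg : IsBoundedLipschitz r g) :
    IsBoundedLipschitz r (fun M X => Star.star (g M X)) := by
  obtain ⟨⟨C, hC, hgC⟩, ⟨L, hL, hgL⟩⟩ := hg
  refine ⟨⟨C, hC, fun M X hX => by rw [norm_star]; exact hgC M X hX⟩, ⟨L, hL,
    fun M X Y δ hX hY hδ hXY => by rw [d_star]; exact hgL M X Y δ hX hY hδ hXY⟩⟩

theorem of_term (t : Term ι) : IsBoundedLipschitz.{u} r (fun M X => t.eval M X) := by
  induction t with
  | var i => exact var i
  | zero => simpa [Term.eval] using const.{u} (r := r) 0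
  | one => simpa [Term.eval] using const.{u} (r := r) 1
  | add s t hs ht => exact hs.add ht
  | mul s t hs ht => exact hs.mul ht
  | star t ht => exact ht.star
  | smul c t ht =>
    simpa only [Term.eval, Algebra.smul_def] using (const c).mul ht
  | poly n p t ht =>
    simp only [Term.eval]
    induction p using FreeAlgebra.induction with
    | grade0 c => simpa only [AlgHom.commutes] using const c
    | grade1 i => simpa only [FreeAlgebra.lift_ι_apply] using ht i
    | mul a b ha hb => simpa only [map_mul] using ha.mul hb
    | add a b ha hb => simpa only [map_add] using ha.add hb

end IsBoundedLipschitz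

/-- Terms have norm bounds independent of the model, and a connective is bounded on the compact box
containing the values of its arguments. -/
theorem QFFormula.exists_abs_eval_le {ι : Type} (r : ι → ℝ) (ψ : QFFormula ι) :
    ∃ C : ℝ, ∀ (M : TracialWStarAlgebra.{u}) (X : ι → M), (∀ i, X i ∈ M.D (r i)) →
      |ψ.eval M X| ≤ C := by
  induction ψ with
  | d s t =>
    obtain ⟨C, hC, hs⟩ := (IsBoundedLipschitz.of_term.{u} (r := r) s).bounded
    obtain ⟨C', hC', ht⟩ := (IsBoundedLipschitz.of_term.{u} (r := r) t).bounded
    refine ⟨C + C', fun M X hX => ?_⟩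
    simp only [QFFormula.eval]
    rw [abs_of_nonneg (d_nonneg _ _)]
    exact (d_le_norm_sub _ _).trans ((norm_sub_le _ _).trans (add_le_add (hs M X hX) (ht M X hX)))
  | reTr t =>
    obtain ⟨C, hC, ht⟩ := (IsBoundedLipschitz.of_term.{u} (r := r) t).bounded
    exact ⟨C, fun M X hX => (Complex.abs_re_le_norm _).trans ((norm_tr_le _).trans (ht M X hX))⟩
  | imTr t =>
    obtain ⟨C, hC, ht⟩ := (IsBoundedLipschitz.of_term.{u} (r := r) t).bounded
    exact ⟨C, fun M X hX => (Complex.abs_im_le_norm _).trans ((norm_tr_le _).trans (ht M X hX))⟩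
  | conn n F φ h =>
    choose C hC using h
    have hK : IsCompact (Set.univ.pi fun i => Set.Icc (-C i) (C i)) :=
      isCompact_univ_pi fun i => isCompact_Icc
    obtain ⟨B, hB⟩ := hK.exists_bound_of_continuousOn F.continuous.continuousOn
    exact ⟨B, fun M X hX => hB _ fun i _ => abs_le.1 (hC i M X hX)⟩

theorem QFFormula.exists_uniform_continuity {ι : Type} (r : ι → ℝ) (ψ : QFFormula ι) (ε : ℝ)
    (hε : 0 < ε) : ∃ δ : ℝ, 0 < δ ∧ ∀ (M : TracialWStarAlgebra.{u}) (X Y : ι → M),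
      (∀ i, X i ∈ M.D (r i)) → (∀ i, Y i ∈ M.D (r i)) → (∀ i, M.d (X i) (Y i) ≤ δ) →
        |ψ.eval M X - ψ.eval M Y| < ε := by
  have hterm : ∀ (t : Term ι) (ε : ℝ), 0 < ε → ∃ δ : ℝ, 0 < δ ∧
      ∀ (M : TracialWStarAlgebra.{u}) (X Y : ι → M),
      (∀ i, X i ∈ M.D (r i)) → (∀ i, Y i ∈ M.D (r i)) → (∀ i, M.d (X i) (Y i) ≤ δ) →
        M.d (t.eval M X) (t.eval M Y) < ε := by
    intro t ε hε
    obtain ⟨L, hL, ht⟩ := (IsBoundedLipschitz.of_term.{u} (r := r) t).lipschitz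
    -- The summand 1 allows for `L = 0`.
    refine ⟨ε / (L + 1), by positivity, fun M X Y hX hY hXY =>
      (ht M X Y _ hX hY (by positivity) hXY).trans_lt ?_⟩
    rw [mul_div_assoc', div_lt_iff₀ (by positivity)]
    nlinarith
  induction ψ generalizing ε with
  | d s t =>
    obtain ⟨δ, hδ, hs⟩ := hterm s (ε / 2) (by positivity)
    obtain ⟨δ', hδ', ht⟩ := hterm t (ε / 2) (by positivity)
    refine ⟨min δ δ', lt_min hδ hδ', fun M X Y hX hY hXY => ?_⟩
    have h1 := hs M X Y hX hY fun i => (hXY i).trans (min_le_left _ _)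
    have h2 := ht M X Y hX hY fun i => (hXY i).trans (min_le_right _ _)
    exact (abs_d_sub_d_le _ _ _ _).trans_lt (by linarith)
  | reTr t =>
    obtain ⟨δ, hδ, ht⟩ := hterm t ε hε
    refine ⟨δ, hδ, fun M X Y hX hY hXY => ?_⟩
    simp only [QFFormula.eval]
    rw [← Complex.sub_re]
    exact ((Complex.abs_re_le_norm _).trans (norm_tr_sub_tr_le _ _)).trans_lt (ht M X Y hX hY hXY)
  | imTr t =>
    obtain ⟨δ, hδ, ht⟩ := hterm t ε hε
    refine ⟨δ, hδ, fun M X Y hX hY hXY => ?_⟩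
    simp only [QFFormula.eval]
    rw [← Complex.sub_im]
    exact ((Complex.abs_im_le_norm _).trans (norm_tr_sub_tr_le _ _)).trans_lt (ht M X Y hX hY hXY)
  | conn n F φ h =>
    choose C hC using fun i => (φ i).exists_abs_eval_le.{u} r
    have hK : IsCompact (Set.univ.pi fun i => Set.Icc (-C i) (C i)) :=
      isCompact_univ_pi fun i => isCompact_Icc
    obtain ⟨η, hη, hF⟩ := Metric.uniformContinuousOn_iff.1
      (hK.uniformContinuousOn_of_continuous F.continuous.continuousOn) ε hε
    choose δ hδ hφ using fun i => h i η hη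
    obtain ⟨δ₀, hδ₀, hle⟩ : ∃ δ₀ : ℝ, 0 < δ₀ ∧ ∀ i, δ₀ ≤ δ i := by
      -- A connective of arity zero imposes no condition, so any positive `δ₀` serves.
      rcases isEmpty_or_nonempty (Fin n) with hn | hn
      · exact ⟨1, one_pos, fun i => hn.elim i⟩
      · obtain ⟨i, hi⟩ := Finite.exists_min δ
        exact ⟨δ i, hδ i, hi⟩
    refine ⟨δ₀, hδ₀, fun M X Y hX hY hXY => ?_⟩
    refine hF _ (fun i _ => abs_le.1 (hC i M X hX)) _ (fun i _ => abs_le.1 (hC i M Y hY)) ?_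
    rw [dist_pi_lt_iff hη]
    exact fun i => hφ i M X Y hX hY fun j => (hXY j).trans (hle i)

/-! ### Compactness of the space of quantifier-free types -/

theorem exists_cstarProduct {I : Type} (E : I → Type u) [∀ i, Nontrivial (E i)]
    [∀ i, CStarAlgebra (E i)] :
    ∃ (B : Type u) (_ : CStarAlgebra B) (ev : ∀ i, B →⋆ₐ[ℂ] E i),
      ∀ (x : ∀ i, E i) (C : ℝ), 0 ≤ C → (∀ i, ‖x i‖ ≤ C) → ∃ b, ‖b‖ ≤ C ∧ ∀ i, ev i b = x i := by
  let _ : CStarAlgebra (lp E ∞) := {}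
  let ev : ∀ i, lp E ∞ →⋆ₐ[ℂ] E i := fun i =>
    { toFun := fun a => a i
      map_one' := rfl
      map_mul' := fun _ _ => rfl
      map_zero' := rfl
      map_add' := fun _ _ => rfl
      commutes' := fun _ => rfl
      map_star' := fun _ => rfl }
  refine ⟨lp E ∞, inferInstance, ev, fun x C hC hx => ?_⟩
  have hmem : Memℓp x ∞ := memℓp_infty ⟨C, by rintro _ ⟨i, rfl⟩; exact hx i⟩
  exact ⟨⟨x, hmem⟩, lp.norm_le_of_forall_le hC hx, fun i => rfl⟩

/-- The `C⋆`-subalgebra generated by a tuple. -/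
theorem exists_generated_cstarAlgebra {B : Type u} [CStarAlgebra B] {ι : Type} (X : ι → B) :
    ∃ (A : Type u) (_ : CStarAlgebra A) (j : A →⋆ₐ[ℂ] B) (Y : ι → A),
      (∀ i, j (Y i) = X i) ∧ (∀ i, ‖Y i‖ ≤ ‖X i‖) ∧
      ∀ (a : A) (ε : ℝ), 0 < ε → ∃ t : Term ι, ‖a - t.aeval Y‖ < ε := by
  let S₀ : StarSubalgebra ℂ B := StarAlgebra.adjoin ℂ (Set.range X)
  let S : StarSubalgebra ℂ B := S₀.topologicalClosure
  have hS : IsClosed (S : Set B) := S₀.isClosed_topologicalClosure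
  have hX : ∀ i, X i ∈ S := fun i =>
    S₀.le_topologicalClosure (StarAlgebra.subset_adjoin ℂ _ ⟨i, rfl⟩)
  refine ⟨S, inferInstance, S.subtype, fun i => ⟨X i, hX i⟩, fun i => rfl, fun i => le_rfl,
    fun a ε hε => ?_⟩
  have hterm : ∀ b ∈ S₀, ∃ t : Term ι, t.aeval X = b := by
    intro b hb
    induction hb using StarAlgebra.adjoin_induction with
    | mem x hx =>
      obtain ⟨i, rfl⟩ := hx
      exact ⟨.var i, rfl⟩
    | algebraMap c => exact ⟨.smul c .one, (Algebra.algebraMap_eq_smul_one c).symm⟩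
    | add x y _ _ hx hy =>
      obtain ⟨s, rfl⟩ := hx
      obtain ⟨t, rfl⟩ := hy
      exact ⟨.add s t, rfl⟩
    | mul x y _ _ hx hy =>
      obtain ⟨s, rfl⟩ := hx
      obtain ⟨t, rfl⟩ := hy
      exact ⟨.mul s t, rfl⟩
    | star x _ hx =>
      obtain ⟨t, rfl⟩ := hx
      exact ⟨.star t, rfl⟩
  have ha : (a : B) ∈ closure (S₀ : Set B) := a.2
  obtain ⟨b, hb, hab⟩ := Metric.mem_closure_iff.1 ha ε hε
  obtain ⟨t, rfl⟩ := hterm b hb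
  refine ⟨t, ?_⟩
  rw [dist_eq_norm] at hab
  have h1 := Term.map_aeval S.subtype (fun i => (⟨X i, hX i⟩ : S)) t
  calc ‖a - t.aeval (fun i => (⟨X i, hX i⟩ : S))‖
      = ‖(a : B) - S.subtype (t.aeval (fun i => (⟨X i, hX i⟩ : S)))‖ := rfl
    _ < ε := by rw [h1]; exact hab

/-- The ultralimit of the traces. -/
theorem exists_ultralimit_trace {I : Type} (U : Ultrafilter I) (M : I → TracialWStarAlgebra.{u})
    {A : Type u} [CStarAlgebra A] (ev : ∀ i, A →⋆ₐ[ℂ] M i) :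
    ∃ τ : A →ₗ[ℂ] ℂ, (∀ a, Filter.Tendsto (fun i => (M i).tr (ev i a)) U (𝓝 (τ a))) ∧
      (∀ x, 0 ≤ (τ (star x * x)).re ∧ (τ (star x * x)).im = 0) ∧ τ 1 = 1 ∧
      ∀ x y, τ (x * y) = τ (y * x) := by
  have hlim : ∀ a, ∃ z, Filter.Tendsto (fun i => (M i).tr (ev i a)) U (𝓝 z) := by
    intro a
    obtain ⟨z, -, hz⟩ := (isCompact_closedBall (0 : ℂ) ‖a‖).ultrafilter_le_nhds
      (U.map fun i => (M i).tr (ev i a)) (by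
        rw [Filter.le_principal_iff, Ultrafilter.coe_map, Filter.mem_map]
        refine Filter.Eventually.of_forall fun i => ?_
        change dist _ _ ≤ _
        rw [dist_zero_right]
        exact (TracialWStarAlgebra.norm_tr_le _).trans
          (NonUnitalStarAlgHom.norm_apply_le (ev i) a))
    exact ⟨z, hz⟩
  choose τ hτ using hlim
  refine ⟨{ toFun := τ, map_add' := fun a b => ?_, map_smul' := fun c a => ?_ }, hτ, fun x => ?_,
    ?_, fun x y => ?_⟩
  · refine tendsto_nhds_unique (hτ (a + b)) ?_
    simpa only [map_add] using (hτ a).add (hτ b)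
  · refine tendsto_nhds_unique (hτ (c • a)) ?_
    simpa only [map_smul, RingHom.id_apply] using (hτ a).const_smul c
  · have h := hτ (star x * x)
    simp only [map_mul, map_star] at h
    constructor
    · exact ge_of_tendsto ((Complex.continuous_re.tendsto _).comp h)
        (Filter.Eventually.of_forall fun i => ((M i).tr_star_mul_self _).1)
    · refine tendsto_nhds_unique ((Complex.continuous_im.tendsto _).comp h) ?_
      refine tendsto_const_nhds.congr fun i => ?_
      exact ((M i).tr_star_mul_self _).2.symm
  · refine tendsto_nhds_unique (hτ 1) ?_
    refine tendsto_const_nhds.congr fun i => ?_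
    rw [map_one, (M i).tr_one]
  · refine tendsto_nhds_unique (hτ (x * y)) ?_
    refine (hτ (y * x)).congr fun i => ?_
    rw [map_mul (ev i), map_mul (ev i), (M i).tr_mul_comm]

/-- Once distances are expressed by traces of terms, those traces determine the value of every
formula. -/
theorem TracialWStarAlgebra.d_eval_eq {ι : Type} (M : TracialWStarAlgebra.{u}) (X : ι → M)
    (s t : Term ι) : M.d (s.eval M X) (t.eval M X) =
      Real.sqrt (M.tr ((Term.mul (.star (.add s (.smul (-1) t)))
        (.add s (.smul (-1) t))).eval M X)).re := by
  simp only [TracialWStarAlgebra.d, Term.eval, neg_smul, one_smul, ← sub_eq_add_neg]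

theorem QFFormula.tendsto_eval {ι I : Type} {l : Filter I} {M : I → TracialWStarAlgebra.{u}}
    {X : ∀ i, ι → M i} {N : TracialWStarAlgebra.{u}} {Y : ι → N}
    (h : ∀ t : Term ι, Filter.Tendsto (fun i => (M i).tr (t.eval (M i) (X i))) l
      (𝓝 (N.tr (t.eval N Y)))) (ψ : QFFormula ι) :
    Filter.Tendsto (fun i => ψ.eval (M i) (X i)) l (𝓝 (ψ.eval N Y)) := by
  induction ψ with
  | d s t =>
    simp only [QFFormula.eval, TracialWStarAlgebra.d_eval_eq]
    exact (Real.continuous_sqrt.tendsto _).comp ((Complex.continuous_re.tendsto _).comp (h _))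
  | reTr t => exact (Complex.continuous_re.tendsto _).comp (h t)
  | imTr t => exact (Complex.continuous_im.tendsto _).comp (h t)
  | conn n F φ hφ => exact (F.continuous.tendsto _).comp (tendsto_pi_nhds.2 hφ)

/-- A limit of quantifier-free types is realised by a tuple that generates a tracial
`W⋆`-algebra. -/
theorem exists_generating_tuple {ι : Type} {r : ι → ℝ} (hr : ∀ i, 0 < r i)
    {ν : QFFormula ι → ℝ} (hν : ν ∈ closure (QFTypesOn.{u} r)) :
    ∃ (N : TracialWStarAlgebra.{u}) (Y : ι → N), (∀ i, Y i ∈ N.D (r i)) ∧ qfType N Y = ν ∧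
      ∀ (y : N) (ε : ℝ), 0 < ε → ∃ t : Term ι, N.d y (t.eval N Y) < ε := by
  have hne : (Filter.comap (Subtype.val : QFTypesOn.{u} r → _) (𝓝 ν)).NeBot :=
    mem_closure_iff_comap_neBot.1 hν
  -- The ultrafilter lives on the set of types, with one realising model chosen for each, since the
  -- models themselves form a proper class.
  let U : Ultrafilter (QFTypesOn.{u} r) := Ultrafilter.of (Filter.comap Subtype.val (𝓝 ν))
  have hU : Filter.Tendsto (Subtype.val : QFTypesOn.{u} r → _) U (𝓝 ν) :=
    Filter.tendsto_comap.mono_left (Ultrafilter.of_le _)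
  choose M X hX hM using fun i : QFTypesOn.{u} r => i.2
  obtain ⟨B, _, ev, hB⟩ := exists_cstarProduct fun i => (M i : Type u)
  choose Z hZr hZ using fun j : ι => hB (fun i => X i j) (r j) (hr j).le fun i => hX i j
  obtain ⟨A, _, inc, Y, hYZ, hYn, hA⟩ := exists_generated_cstarAlgebra Z
  obtain ⟨τ, hτ, hpos, hone, htr⟩ := exists_ultralimit_trace U M fun i => (ev i).comp inc
  -- The ultralimit `τ` need not be faithful; the trace on the commutant is.
  obtain ⟨N, π, hπ, hdense⟩ := exists_tracialWStarAlgebra τ hpos hone htr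
  have hterm : ∀ t : Term ι, π (t.aeval Y) = t.eval N (fun j => π (Y j)) := fun t => by
    rw [Term.map_aeval, Term.eval_eq_aeval]
  refine ⟨N, fun j => π (Y j), fun j => ?_, ?_, fun y ε hε => ?_⟩
  · exact (NonUnitalStarAlgHom.norm_apply_le π (Y j)).trans ((hYn j).trans (hZr j))
  · have key : ∀ ψ : QFFormula ι, Filter.Tendsto (fun i => ψ.eval (M i) (X i)) U
        (𝓝 (ψ.eval N fun j => π (Y j))) := by
      refine QFFormula.tendsto_eval fun t => ?_
      rw [← hterm, hπ]
      refine (hτ (t.aeval Y)).congr fun i => ?_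
      rw [Term.map_aeval, Term.eval_eq_aeval]
      simp only [StarAlgHom.comp_apply, hYZ, hZ]
    funext ψ
    refine tendsto_nhds_unique (key ψ) ?_
    refine ((continuous_apply ψ).tendsto ν |>.comp hU).congr fun i => ?_
    exact (congrFun (hM i) ψ).symm
  · obtain ⟨a, ha⟩ := hdense y (ε / 2) (by positivity)
    obtain ⟨t, ht⟩ := hA a (ε / 2) (by positivity)
    refine ⟨t, (TracialWStarAlgebra.d_triangle y (π a) _).trans_lt ?_⟩
    rw [← hterm]
    have h1 := TracialWStarAlgebra.d_le_norm_sub (π a) (π (t.aeval Y))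
    rw [← map_sub] at h1
    have h2 := NonUnitalStarAlgHom.norm_apply_le π (a - t.aeval Y)
    linarith

theorem isCompact_QFTypesOn {ι : Type} {r : ι → ℝ} (hr : ∀ i, 0 < r i) :
    IsCompact (QFTypesOn.{u} r) := by
  choose C hC using fun ψ : QFFormula ι => ψ.exists_abs_eval_le.{u} r
  refine (isCompact_univ_pi fun ψ => isCompact_Icc (a := -C ψ) (b := C ψ)).of_isClosed_subset
    (closure_subset_iff_isClosed.1 fun ν hν => ?_) ?_
  · obtain ⟨N, Y, hY, hν, -⟩ := exists_generating_tuple hr hν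
    exact ⟨N, Y, hY, hν⟩
  · rintro _ ⟨M, X, hX, rfl⟩ ψ -
    exact abs_le.1 (hC ψ M X hX)

/-! ### Approximation of bounded elements by bounded terms -/

section CStar

variable {B : Type*} [CStarAlgebra B]

theorem mem_Icc_of_mem_spectrum_mul_star {a : B} {t : ℝ} (ht : t ∈ spectrum ℝ (a * star a)) :
    0 ≤ t ∧ t ≤ ‖a‖ ^ 2 := by
  have : Nontrivial B := by
    by_contra hB
    rw [not_nontrivial_iff_subsingleton] at hB
    exact absurd ht (by simp)
  constructor
  · have h := spectrum_star_mul_self_nonneg (b := star a)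
    rw [star_star] at h
    exact h t ht
  · have h := spectrum.norm_le_norm_of_mem ht
    rw [CStarRing.norm_self_mul_star, ← sq] at h
    exact (le_abs_self t).trans h

/-- By the C*-identity the squared norm is that of `t ↦ (√t h(t))²` applied to `a a⋆`, whose
spectrum lies in `[0, C²]`; the hypothesis is the bound at `s = √t`. -/
theorem norm_cfc_mul_le {a : B} {C K : ℝ} (haC : ‖a‖ ≤ C) (hK : 0 ≤ K) {h : ℝ → ℝ}
    (hc : Continuous h) (hle : ∀ s, 0 ≤ s → s ≤ C → |s * h (s ^ 2)| ≤ K) :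
    ‖cfc h (a * star a) * a‖ ≤ K := by
  have hsa : IsSelfAdjoint (a * star a) := IsSelfAdjoint.mul_star_self a
  rw [← abs_of_nonneg (norm_nonneg _), ← abs_of_nonneg hK, ← sq_le_sq, sq,
    ← CStarRing.norm_self_mul_star]
  have h1 : cfc h (a * star a) * a * star (cfc h (a * star a) * a) =
      cfc (fun t => h t * t * h t) (a * star a) := by
    rw [cfc_mul (fun t => h t * t) h _ (by fun_prop) (by fun_prop),
      cfc_mul h (fun t => t) _ (by fun_prop) (by fun_prop), cfc_id' ℝ (a * star a), star_mul,
      (cfc_predicate h (a * star a) : IsSelfAdjoint _).star_eq]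
    simp only [mul_assoc]
  rw [h1]
  refine norm_cfc_le (by positivity) fun t ht => ?_
  obtain ⟨h0, h2⟩ := mem_Icc_of_mem_spectrum_mul_star ht
  have h3 := hle (Real.sqrt t) (Real.sqrt_nonneg _)
    (Real.sqrt_le_iff.2 ⟨(norm_nonneg a).trans haC, h2.trans (by gcongr)⟩)
  rw [Real.sq_sqrt h0] at h3
  have h4 : h t * t * h t = (Real.sqrt t * h t) ^ 2 := by
    rw [mul_pow, Real.sq_sqrt h0]
    ring
  rw [h4, norm_pow, Real.norm_eq_abs]
  gcongr

/-- The absolute value gives continuity on the whole line and changes nothing on the nonnegative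
spectrum of `a a⋆`. -/
theorem continuous_inv_one_add_abs : Continuous fun t : ℝ => (1 + |t|)⁻¹ :=
  Continuous.inv₀ (by fun_prop) fun t => by positivity

/-- The element `(1 + a a⋆)⁻¹`. -/
noncomputable def resolvent (a : B) : B := cfc (fun t : ℝ => (1 + |t|)⁻¹) (a * star a)

theorem resolvent_mul (a : B) : resolvent a * (1 + a * star a) = 1 := by
  have hsa : IsSelfAdjoint (a * star a) := IsSelfAdjoint.mul_star_self a
  have h1 : (1 : B) + a * star a = cfc (fun t : ℝ => 1 + t) (a * star a) := by
    rw [cfc_add (a * star a) (fun _ : ℝ => (1 : ℝ)) (fun t => t) (by fun_prop) (by fun_prop),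
      cfc_const_one ℝ (a * star a), cfc_id' ℝ (a * star a)]
  rw [resolvent, h1, ← cfc_mul _ _ _ continuous_inv_one_add_abs.continuousOn (by fun_prop),
    ← cfc_const_one ℝ (a * star a)]
  refine cfc_congr fun t ht => ?_
  have h0 := (mem_Icc_of_mem_spectrum_mul_star ht).1
  change (1 + |t|)⁻¹ * (1 + t) = 1
  rw [abs_of_nonneg h0]
  exact inv_mul_cancel₀ (by positivity)

theorem star_resolvent (a : B) : star (resolvent a) = resolvent a :=
  (cfc_predicate (R := ℝ) (p := IsSelfAdjoint) _ _ : IsSelfAdjoint _).star_eq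

theorem mul_resolvent (a : B) : (1 + a * star a) * resolvent a = 1 := by
  have := congrArg star (resolvent_mul a)
  simpa [star_mul, star_resolvent] using this

theorem norm_resolvent_le (a : B) : ‖resolvent a‖ ≤ 1 := by
  refine norm_cfc_le zero_le_one fun t _ => ?_
  rw [norm_inv, Real.norm_of_nonneg (by positivity)]
  exact inv_le_one_of_one_le₀ (by linarith [abs_nonneg t])

theorem norm_resolvent_mul_le (a : B) : ‖resolvent a * a‖ ≤ 1 / 2 := by
  refine norm_cfc_mul_le le_rfl (by norm_num) continuous_inv_one_add_abs fun s hs _ => ?_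
  rw [abs_of_nonneg (by positivity), abs_of_nonneg (by positivity), ← div_eq_mul_inv,
    div_le_div_iff₀ (by positivity) (by norm_num)]
  nlinarith [sq_nonneg (s - 1)]

theorem resolvent_mul_self (b : B) : resolvent b * b = b * resolvent (star b) := by
  have h1 := mul_resolvent (star b)
  rw [star_star] at h1
  calc resolvent b * b = resolvent b * b * ((1 + star b * b) * resolvent (star b)) := by
        rw [h1, mul_one]
    _ = resolvent b * (1 + b * star b) * b * resolvent (star b) := by noncomm_ring
    _ = b * resolvent (star b) := by rw [resolvent_mul, one_mul]

/-- A resolvent identity: each difference is flanked by factors that are bounded whatever the norms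
of `a` and `b`. This yields a Lipschitz constant for the metric of the trace. -/
theorem resolvent_mul_sub (a b : B) : resolvent a * a - resolvent b * b =
    resolvent a * (a - b) * resolvent (star b) +
      resolvent a * a * (star b - star a) * (b * resolvent (star b)) := by
  have h1 := mul_resolvent (star b)
  rw [star_star] at h1
  calc resolvent a * a - resolvent b * b
      = resolvent a * a * ((1 + star b * b) * resolvent (star b)) -
        resolvent a * (1 + a * star a) * (b * resolvent (star b)) := by
        rw [h1, mul_one, resolvent_mul, one_mul, resolvent_mul_self b]
    _ = _ := by noncomm_ring

/-- Every contraction is of the form `2 (1 + z z⋆)⁻¹ z`. -/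
theorem exists_resolvent_mul_eq {y : B} (hy : ‖y‖ ≤ 1) :
    ∃ z : B, resolvent z * z + resolvent z * z = y := by
  have hsa : IsSelfAdjoint (y * star y) := IsSelfAdjoint.mul_star_self y
  -- With `z = s y`, the requirement is `2 s = 1 + z z⋆`, that is `2 h = 1 + t h²`; this `h` is the
  -- root that stays regular at `t = 0`.
  let h : ℝ → ℝ := fun t => (1 + Real.sqrt (1 - t))⁻¹
  have hc : Continuous h := Continuous.inv₀ (by fun_prop) fun t => by positivity
  let s := cfc h (y * star y)
  have hs : star s = s := (cfc_predicate h (y * star y) : IsSelfAdjoint _).star_eq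
  have h1 : s + s = 1 + s * y * star (s * y) := by
    have h2 : s * y * star (s * y) = cfc (fun t => h t * t * h t) (y * star y) := by
      rw [cfc_mul (fun t => h t * t) h _ (by fun_prop) (by fun_prop),
        cfc_mul h (fun t => t) _ (by fun_prop) (by fun_prop), cfc_id' ℝ (y * star y), star_mul, hs]
      simp only [mul_assoc, s]
    rw [h2, ← cfc_const_one ℝ (y * star y), ← cfc_add _ _ _ (by fun_prop) (by fun_prop),
      ← cfc_add _ _ _ (by fun_prop) (by fun_prop)]
    refine cfc_congr fun t ht => ?_
    obtain ⟨-, ht1⟩ := mem_Icc_of_mem_spectrum_mul_star ht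
    have ht2 : 0 ≤ 1 - t := by nlinarith [norm_nonneg y]
    have ht3 : t = 1 - Real.sqrt (1 - t) ^ 2 := by rw [Real.sq_sqrt ht2]; ring
    have ht4 : 0 < 1 + Real.sqrt (1 - t) := by positivity
    change (1 + Real.sqrt (1 - t))⁻¹ + (1 + Real.sqrt (1 - t))⁻¹ =
      1 + (1 + Real.sqrt (1 - t))⁻¹ * t * (1 + Real.sqrt (1 - t))⁻¹
    generalize Real.sqrt (1 - t) = k at ht3 ht4
    rw [ht3]
    field_simp
    ring
  refine ⟨s * y, ?_⟩
  calc resolvent (s * y) * (s * y) + resolvent (s * y) * (s * y)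
      = resolvent (s * y) * (s + s) * y := by noncomm_ring
    _ = y := by rw [h1, resolvent_mul, one_mul]

end CStar

theorem TracialWStarAlgebra.d_resolvent_mul_le {M : TracialWStarAlgebra.{u}} (a b : M) :
    M.d (resolvent a * a) (resolvent b * b) ≤ 2 * M.d a b := by
  obtain ⟨H, _, _, v, h, hd, -⟩ := M.exists_rep
  rw [hd, hd, ← map_sub, ← map_sub, resolvent_mul_sub, map_add]
  have h1 : ‖v (resolvent a * (a - b) * resolvent (star b))‖ ≤ 1 * (1 * ‖v (a - b)‖) :=
    (h.norm_mul_le' _ _).trans (mul_le_mul (norm_resolvent_le _)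
      ((h.norm_mul_le _ _).trans (mul_le_mul_of_nonneg_right (norm_resolvent_le _)
        (norm_nonneg _))) (norm_nonneg _) zero_le_one)
  have h2 : ‖v (resolvent a * a * (star b - star a) * (b * resolvent (star b)))‖ ≤
      1 / 2 * (1 / 2 * ‖v (a - b)‖) := by
    refine (h.norm_mul_le' _ _).trans (mul_le_mul ?_ ((h.norm_mul_le _ _).trans
      (mul_le_mul (norm_resolvent_mul_le _) ?_ (norm_nonneg _) (by norm_num)))
        (norm_nonneg _) (by norm_num))
    · rw [← resolvent_mul_self]
      exact norm_resolvent_mul_le b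
    · rw [← star_sub, h.norm_star, ← norm_neg, ← map_neg, neg_sub]
  have h3 := norm_add_le (v (resolvent a * (a - b) * resolvent (star b)))
    (v (resolvent a * a * (star b - star a) * (b * resolvent (star b))))
  nlinarith [norm_nonneg (v (a - b))]

/-- A polynomial approximation of `2 / (1 + t)` that preserves the bound by one of
`2 √t / (1 + t)`. -/
theorem exists_polynomial_approx {C δ : ℝ} (hC : 0 ≤ C) (hδ : 0 < δ) :
    ∃ q : Polynomial ℝ, (∀ s, 0 ≤ s → s ≤ C → |s * q.eval (s ^ 2)| ≤ 1) ∧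
      ∀ s, 0 ≤ s → s ≤ C → |s * (q.eval (s ^ 2) - 2 * (1 + |s ^ 2|)⁻¹)| ≤ δ := by
  -- The approximation costs at most `C η`, and so does dividing by `1 + C η` to restore the bound
  -- by one; together at most `δ`.
  let η : ℝ := δ / (2 * (C + 1))
  have hη : 0 < η := by positivity
  obtain ⟨p, hp⟩ := exists_polynomial_near_of_continuousOn 0 (C ^ 2)
    (fun t => 2 * (1 + |t|)⁻¹) (continuous_inv_one_add_abs.const_mul 2).continuousOn η hη
  have hCη : 2 * (C * η) ≤ δ := by
    have : η * (2 * (C + 1)) = δ := div_mul_cancel₀ _ (by positivity)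
    nlinarith
  have hpos : 0 < 1 + C * η := by positivity
  have key : ∀ s, 0 ≤ s → s ≤ C → |s * (p.eval (s ^ 2) - 2 * (1 + |s ^ 2|)⁻¹)| ≤ C * η := by
    intro s hs hsC
    have := (hp (s ^ 2) ⟨by positivity, by gcongr⟩).le
    rw [abs_mul, abs_of_nonneg hs]
    exact mul_le_mul hsC this (abs_nonneg _) hC
  have key' : ∀ s, 0 ≤ s → s ≤ C → |s * p.eval (s ^ 2)| ≤ 1 + C * η := by
    intro s hs hsC
    have h1 : |s * (2 * (1 + |s ^ 2|)⁻¹)| ≤ 1 := by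
      rw [abs_of_nonneg (by positivity), abs_of_nonneg (by positivity), ← mul_assoc,
        ← div_eq_mul_inv, div_le_one (by positivity)]
      nlinarith [sq_nonneg (s - 1)]
    have h2 := abs_add_le (s * (2 * (1 + |s ^ 2|)⁻¹)) (s * (p.eval (s ^ 2) - 2 * (1 + |s ^ 2|)⁻¹))
    rw [← mul_add, add_sub_cancel] at h2
    linarith [key s hs hsC]
  refine ⟨Polynomial.C (1 + C * η)⁻¹ * p, fun s hs hsC => ?_, fun s hs hsC => ?_⟩
  · rw [Polynomial.eval_mul, Polynomial.eval_C, mul_left_comm, abs_mul,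
      abs_of_nonneg (inv_nonneg.2 hpos.le), inv_mul_le_iff₀ hpos, mul_one]
    exact key' s hs hsC
  · rw [Polynomial.eval_mul, Polynomial.eval_C]
    have h1 : s * ((1 + C * η)⁻¹ * p.eval (s ^ 2) - 2 * (1 + |s ^ 2|)⁻¹) =
        s * (p.eval (s ^ 2) - 2 * (1 + |s ^ 2|)⁻¹) +
          -((C * η) * (1 + C * η)⁻¹ * (s * p.eval (s ^ 2))) := by
      field_simp
      ring
    have h2 : |-((C * η) * (1 + C * η)⁻¹ * (s * p.eval (s ^ 2)))| ≤ C * η := by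
      rw [abs_neg, abs_mul, abs_of_nonneg (by positivity), mul_assoc]
      refine mul_le_of_le_one_right (by positivity) ?_
      rw [inv_mul_le_iff₀ hpos, mul_one]
      exact key' s hs hsC
    rw [h1]
    refine (abs_add_le _ _).trans ?_
    linarith [key s hs hsC]

theorem Term.exists_eval_eq_aeval_polynomial {ι : Type} (t : Term ι) (q : Polynomial ℝ) :
    ∃ s : Term ι, ∀ (M : TracialWStarAlgebra.{u}) (X : ι → M),
      s.eval M X = Polynomial.aeval (t.eval M X) q := by
  induction q using Polynomial.induction_on' with
  | add p q hp hq =>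
    obtain ⟨s, hs⟩ := hp
    obtain ⟨s', hs'⟩ := hq
    exact ⟨.add s s', fun M X => by simp only [Term.eval, hs, hs', map_add]⟩
  | monomial n c =>
    have hpow : ∃ s : Term ι, ∀ (M : TracialWStarAlgebra.{u}) (X : ι → M),
        s.eval M X = t.eval M X ^ n := by
      induction n with
      | zero => exact ⟨.one, fun M X => by rw [pow_zero]; rfl⟩
      | succ n ih =>
        obtain ⟨s, hs⟩ := ih
        exact ⟨.mul s t, fun M X => by rw [pow_succ, ← hs]; rfl⟩
    obtain ⟨s, hs⟩ := hpow
    refine ⟨.smul c s, fun M X => ?_⟩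
    rw [Polynomial.aeval_monomial, ← hs, ← Algebra.smul_def, ← Complex.coe_smul]
    rfl

/-- Truncation of terms. -/
theorem Term.exists_bounded_approx {ι : Type} (r : ι → ℝ) (a : Term ι) {δ : ℝ} (hδ : 0 < δ) :
    ∃ g : Term ι, ∀ (M : TracialWStarAlgebra.{u}) (X : ι → M), (∀ i, X i ∈ M.D (r i)) →
      ‖g.eval M X‖ ≤ 1 ∧ ‖g.eval M X - (resolvent (a.eval M X) * a.eval M X +
        resolvent (a.eval M X) * a.eval M X)‖ ≤ δ := by
  obtain ⟨C, hC, ha⟩ := (IsBoundedLipschitz.of_term.{u} (r := r) a).bounded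
  -- The polynomial depends only on the bound `C`, so one term works in all models.
  obtain ⟨q, hq1, hq2⟩ := exists_polynomial_approx hC hδ
  obtain ⟨s, hs⟩ := Term.exists_eval_eq_aeval_polynomial.{u} (.mul a (.star a)) q
  refine ⟨.mul s a, fun M X hX => ?_⟩
  simp only [Term.eval, hs]
  have hx := ha M X hX
  generalize a.eval M X = x at hx
  have hsa : IsSelfAdjoint (x * Star.star x) := IsSelfAdjoint.mul_star_self x
  rw [← cfc_polynomial q (x * Star.star x)]
  refine ⟨norm_cfc_mul_le hx zero_le_one q.continuous hq1, ?_⟩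
  have hc := continuous_inv_one_add_abs
  have h1 : cfc q.eval (x * Star.star x) * x - (resolvent x * x + resolvent x * x) =
      cfc (fun t => q.eval t - 2 * (1 + |t|)⁻¹) (x * Star.star x) * x := by
    rw [cfc_sub _ _ _ q.continuous.continuousOn (hc.const_mul 2).continuousOn,
      cfc_const_mul _ _ _ hc.continuousOn, two_smul]
    simp only [resolvent, sub_mul, add_mul]
  rw [h1]
  exact norm_cfc_mul_le hx hδ.le (q.continuous.sub (hc.const_mul 2)) hq2

/-- Kaplansky's density theorem for terms, with a bound that is uniform over all models. -/
theorem exists_bounded_term {ι : Type} {r : ι → ℝ} {N : TracialWStarAlgebra.{u}} {Y : ι → N}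
    (hY : ∀ i, Y i ∈ N.D (r i))
    (hdense : ∀ (y : N) (ε : ℝ), 0 < ε → ∃ t : Term ι, N.d y (t.eval N Y) < ε)
    {R : ℝ} (hR : 0 < R) {y : N} (hy : y ∈ N.D R) {ε : ℝ} (hε : 0 < ε) :
    ∃ g : Term ι, (∀ (M : TracialWStarAlgebra.{u}) (X : ι → M), (∀ i, X i ∈ M.D (r i)) →
      g.eval M X ∈ M.D R) ∧ N.d y (g.eval N Y) < ε := by
  have hRn : ‖(R : ℂ)‖ = R := by rw [Complex.norm_real, Real.norm_of_nonneg hR.le]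
  have hRc : (R : ℂ) ≠ 0 := by exact_mod_cast hR.ne'
  obtain ⟨z, hz⟩ := exists_resolvent_mul_eq (y := (R : ℂ)⁻¹ • y) (by
    rw [norm_smul, norm_inv, hRn, inv_mul_le_iff₀ hR, mul_one]
    exact hy)
  -- No norm control on `t` is needed, as it is truncated afterwards. Two summands with Lipschitz
  -- constant 2 contribute `ε / (2R)` and the truncation `ε / (4R)`.
  obtain ⟨t, ht⟩ := hdense z (ε / (8 * R)) (by positivity)
  obtain ⟨g, hg⟩ := Term.exists_bounded_approx.{u} r t (δ := ε / (4 * R)) (by positivity)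
  refine ⟨.smul R g, fun M X hX => ?_, ?_⟩
  · change ‖(R : ℂ) • g.eval M X‖ ≤ R
    rw [norm_smul, hRn]
    exact mul_le_of_le_one_right hR.le (hg M X hX).1
  · have h1 : y = (R : ℂ) • (resolvent z * z + resolvent z * z) := by
      rw [hz, smul_smul, mul_inv_cancel₀ hRc, one_smul]
    have h2 := (hg N Y hY).2
    have h3 : N.d (resolvent z * z + resolvent z * z) (g.eval N Y) < ε / R := by
      refine (TracialWStarAlgebra.d_triangle _ (resolvent (t.eval N Y) * t.eval N Y +
        resolvent (t.eval N Y) * t.eval N Y) _).trans_lt ?_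
      have h4 := TracialWStarAlgebra.d_add_le (resolvent z * z) (resolvent z * z)
        (resolvent (t.eval N Y) * t.eval N Y) (resolvent (t.eval N Y) * t.eval N Y)
      have h5 := TracialWStarAlgebra.d_resolvent_mul_le z (t.eval N Y)
      have h6 := TracialWStarAlgebra.d_le_norm_sub (resolvent (t.eval N Y) * t.eval N Y +
        resolvent (t.eval N Y) * t.eval N Y) (g.eval N Y)
      rw [norm_sub_rev] at h6
      have h7 : ε / (8 * R) = ε / R / 8 := by field_simp
      have h8 : ε / (4 * R) = ε / R / 4 := by field_simp
      have h9 : 0 < ε / R := by positivity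
      linarith
    rw [h1]
    change N.d _ ((R : ℂ) • g.eval N Y) < ε
    rw [TracialWStarAlgebra.d_smul, hRn]
    rwa [lt_div_iff₀' hR] at h3

/-! ### Functions that are given by formulas -/

/-- A family of real-valued functions that is the interpretation of a formula. -/
def IsFormula {ι : Type} (θ : (M : TracialWStarAlgebra.{u}) → (ι → M) → ℝ) : Prop :=
  ∃ ψ : QFFormula ι, ∀ M X, θ M X = ψ.eval M X

theorem IsFormula.conn {ι κ : Type} [Fintype κ] (F : C(κ → ℝ, ℝ))
    {θ : κ → (M : TracialWStarAlgebra.{u}) → (ι → M) → ℝ} (hθ : ∀ j, IsFormula (θ j)) :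
    IsFormula (fun M X => F (fun j => θ j M X)) := by
  choose ψ hψ using hθ
  let e := Fintype.equivFin κ
  refine ⟨.conn (Fintype.card κ) (F.comp ⟨fun x j => x (e j), by fun_prop⟩)
    (fun i => ψ (e.symm i)), fun M X => ?_⟩
  simp only [QFFormula.eval, ContinuousMap.comp_apply, ContinuousMap.coe_mk,
    Equiv.symm_apply_apply, hψ]

theorem IsFormula.comp {ι : Type} {F : ℝ → ℝ} (hF : Continuous F)
    {θ : (M : TracialWStarAlgebra.{u}) → (ι → M) → ℝ} (hθ : IsFormula θ) :
    IsFormula (fun M X => F (θ M X)) :=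
  IsFormula.conn (κ := Unit) ⟨fun x => F (x ()), by fun_prop⟩ fun _ => hθ

theorem IsFormula.mul {ι : Type} {θ η : (M : TracialWStarAlgebra.{u}) → (ι → M) → ℝ}
    (hθ : IsFormula θ) (hη : IsFormula η) : IsFormula (fun M X => θ M X * η M X) :=
  IsFormula.conn (κ := Bool) (θ := fun b => bif b then θ else η)
    ⟨fun x => x true * x false, by fun_prop⟩ (by rintro (_ | _) <;> assumption)

theorem IsFormula.sum {ι κ : Type} [Fintype κ]
    {θ : κ → (M : TracialWStarAlgebra.{u}) → (ι → M) → ℝ} (hθ : ∀ j, IsFormula (θ j)) :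
    IsFormula (fun M X => ∑ j, θ j M X) :=
  IsFormula.conn ⟨fun x => ∑ j, x j, by fun_prop⟩ hθ

/-- A family of functions that is a combination of terms with formulas as coefficients. -/
def IsFormulaCombination {ι : Type} (h : (M : TracialWStarAlgebra.{u}) → (ι → M) → M) : Prop :=
  ∃ (κ : Type) (_ : Fintype κ) (φ : κ → QFFormula ι) (g : κ → Term ι), ∀ M X,
    h M X = ∑ j, (((φ j).eval M X : ℝ) : ℂ) • (g j).eval M X

namespace IsFormulaCombination

variable {ι : Type} {g h : (M : TracialWStarAlgebra.{u}) → (ι → M) → M}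

theorem of_term (t : Term ι) : IsFormulaCombination.{u} (fun M X => t.eval M X) :=
  ⟨Unit, inferInstance, fun _ => .conn 0 (ContinuousMap.const _ 1) Fin.elim0, fun _ => t,
    fun M X => by simp [QFFormula.eval]⟩

theorem add (hg : IsFormulaCombination g) (hh : IsFormulaCombination h) :
    IsFormulaCombination (fun M X => g M X + h M X) := by
  obtain ⟨κ, _, φ, s, hs⟩ := hg
  obtain ⟨κ', _, φ', s', hs'⟩ := hh
  exact ⟨κ ⊕ κ', inferInstance, Sum.elim φ φ', Sum.elim s s', fun M X => by
    simp only [hs, hs', Fintype.sum_sum_type, Sum.elim_inl, Sum.elim_inr]⟩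

theorem mul (hg : IsFormulaCombination g) (hh : IsFormulaCombination h) :
    IsFormulaCombination (fun M X => g M X * h M X) := by
  obtain ⟨κ, _, φ, s, hs⟩ := hg
  obtain ⟨κ', _, φ', s', hs'⟩ := hh
  choose ψ hψ using fun p : κ × κ' =>
    IsFormula.mul.{u} ⟨φ p.1, fun _ _ => rfl⟩ ⟨φ' p.2, fun _ _ => rfl⟩
  refine ⟨κ × κ', inferInstance, ψ, fun p => .mul (s p.1) (s' p.2), fun M X => ?_⟩
  simp only [hs, hs', Fintype.sum_prod_type, Finset.sum_mul_sum, ← hψ, Term.eval,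
    smul_mul_smul_comm, Complex.ofReal_mul]

theorem star (hg : IsFormulaCombination g) :
    IsFormulaCombination (fun M X => Star.star (g M X)) := by
  obtain ⟨κ, _, φ, s, hs⟩ := hg
  refine ⟨κ, inferInstance, φ, fun j => .star (s j), fun M X => ?_⟩
  simp only [hs, star_sum, star_smul, Term.eval]
  simp

theorem bind_term {κ : Type} {H : κ → (M : TracialWStarAlgebra.{u}) → (ι → M) → M}
    (hH : ∀ k, IsFormulaCombination (H k)) (t : Term κ) :
    IsFormulaCombination (fun M X => t.eval M (fun k => H k M X)) := by
  have hconst : ∀ c : ℂ, IsFormulaCombination.{u} (ι := ι) (fun M _ => algebraMap ℂ M c) :=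
    fun c => by
      simpa only [Term.eval, Algebra.algebraMap_eq_smul_one] using of_term (.smul c .one)
  induction t with
  | var i => exact hH i
  | zero => exact of_term .zero
  | one => exact of_term .one
  | add s t hs ht => exact hs.add ht
  | mul s t hs ht => exact hs.mul ht
  | star t ht => exact ht.star
  | smul c t ht => simpa only [Term.eval, Algebra.smul_def] using (hconst c).mul ht
  | poly n p t ht =>
    simp only [Term.eval]
    induction p using FreeAlgebra.induction with
    | grade0 c => simpa only [AlgHom.commutes] using hconst c
    | grade1 i => simpa only [FreeAlgebra.lift_ι_apply] using ht i
    | mul a b ha hb => simpa only [map_mul] using ha.mul hb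
    | add a b ha hb => simpa only [map_add] using ha.add hb

theorem reTr (hg : IsFormulaCombination g) : IsFormula (fun M X => (M.tr (g M X)).re) := by
  obtain ⟨κ, _, φ, s, hs⟩ := hg
  have := IsFormula.sum fun j : κ =>
    IsFormula.mul.{u} ⟨φ j, fun _ _ => rfl⟩ ⟨.reTr (s j), fun _ _ => rfl⟩
  simpa only [hs, map_sum, map_smul, smul_eq_mul, Complex.re_sum, Complex.re_ofReal_mul,
    QFFormula.eval] using this

theorem imTr (hg : IsFormulaCombination g) : IsFormula (fun M X => (M.tr (g M X)).im) := by
  obtain ⟨κ, _, φ, s, hs⟩ := hg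
  have := IsFormula.sum fun j : κ =>
    IsFormula.mul.{u} ⟨φ j, fun _ _ => rfl⟩ ⟨.imTr (s j), fun _ _ => rfl⟩
  simpa only [hs, map_sum, map_smul, smul_eq_mul, Complex.im_sum, Complex.im_ofReal_mul,
    QFFormula.eval] using this

/-- Combinations are closed under the operations of terms, and their real coefficients come out of
the trace, leaving sums of products of formulas. -/
theorem bind_formula {κ : Type} {H : κ → (M : TracialWStarAlgebra.{u}) → (ι → M) → M}
    (hH : ∀ k, IsFormulaCombination (H k)) (ψ : QFFormula κ) :
    IsFormula (fun M X => ψ.eval M (fun k => H k M X)) := by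
  induction ψ with
  | d s t =>
    simp only [QFFormula.eval, TracialWStarAlgebra.d_eval_eq]
    exact (bind_term hH _).reTr.comp Real.continuous_sqrt
  | reTr t => exact (bind_term hH t).reTr
  | imTr t => exact (bind_term hH t).imTr
  | conn n F φ hφ => exact IsFormula.conn F hφ

end IsFormulaCombination

/-! ### Characterisations of definable functions -/

section

variable {f : (M : TracialWStarAlgebra.{u}) → (ℕ → M) → (ℕ → M)}

theorem IsQFDefinableFunction.dist_definable (hf : IsQFDefinableFunction f) (k : ℕ) :
    IsQFDefinablePredicate (fun (M : TracialWStarAlgebra.{u}) (Z : ℕ ⊕ Unit → M) =>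
      M.d (f M (fun j => Z (Sum.inl j)) k) (Z (Sum.inr ()))) := by
  have h1 := hf.comp_predicate
    (fun M W => (QFFormula.d (.var (Sum.inl k)) (.var (Sum.inr 0))).eval M W)
    fun r _ ε hε => ⟨_, fun M X _ => by rwa [sub_self, abs_zero]⟩
  intro r hr ε hε
  obtain ⟨ψ, hψ⟩ := h1 (fun i => r (i.map id fun _ => ())) (fun i => hr _) ε hε
  -- The single variable `y` is substituted for every entry of the second tuple.
  refine ⟨ψ.bind fun i => .var (i.map id fun _ => ()), fun M X hX => ?_⟩
  rw [QFFormula.eval_bind]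
  exact hψ M (fun i => X (i.map id fun _ => ())) fun i => hX _

theorem exists_local_term_approx {R : ℝ} (hR : 0 < R) {k : ℕ}
    (h : IsQFDefinablePredicate (fun (M : TracialWStarAlgebra.{u}) (Z : ℕ ⊕ Unit → M) =>
      M.d (f M (fun j => Z (Sum.inl j)) k) (Z (Sum.inr ()))))
    {r : ℕ → ℝ} (hr : ∀ j, 0 < r j)
    (hf : ∀ (M : TracialWStarAlgebra.{u}) (X : ℕ → M), (∀ j, X j ∈ M.D (r j)) → f M X k ∈ M.D R)
    (μ : QFTypesOn.{u} r) {ε : ℝ} (hε : 0 < ε) :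
    ∃ (g : Term ℕ) (O : Set (QFTypesOn.{u} r)), IsOpen O ∧ μ ∈ O ∧
      ∀ (M : TracialWStarAlgebra.{u}) (X : ℕ → M) (hX : ∀ j, X j ∈ M.D (r j)),
        g.eval M X ∈ M.D R ∧ (qfTypeOn M X hX ∈ O → M.d (f M X k) (g.eval M X) < ε) := by
  obtain ⟨N, Y, hY, hμ, hdense⟩ := exists_generating_tuple hr (subset_closure μ.2)
  obtain ⟨g, hg, hgY⟩ := exists_bounded_term hY hdense hR (hf N Y hY)
    (show 0 < ε / 3 by positivity)
  obtain ⟨ψ, hψ⟩ := h (Sum.elim r fun _ => R) (by rintro (i | i); exacts [hr i, hR]) (ε / 3)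
    (by positivity)
  let χ : QFFormula ℕ := ψ.bind (Sum.elim .var fun _ => g)
  have hχ : ∀ (M : TracialWStarAlgebra.{u}) (X : ℕ → M), (∀ j, X j ∈ M.D (r j)) →
      |M.d (f M X k) (g.eval M X) - χ.eval M X| < ε / 3 := by
    intro M X hX
    have h1 := hψ M (fun i => (Sum.elim Term.var (fun _ => g) i).eval M X)
      (by rintro (i | i); exacts [hX i, hg M X hX])
    rwa [← QFFormula.eval_bind] at h1
  -- At `μ` the distance is below `ε / 3` and `χ` errs by less than `ε / 3`; on this open set the
  -- distance is below `ε`. The bound on `g` in every model is what keeps `χ` accurate there.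
  refine ⟨g, {ν | ν.1 χ < 2 * ε / 3}, ?_, ?_, fun M X hX => ⟨hg M X hX, fun hO => ?_⟩⟩
  · exact isOpen_lt ((continuous_apply χ).comp continuous_subtype_val) continuous_const
  · have h1 := abs_lt.1 (hχ N Y hY)
    have h2 : μ.1 χ = χ.eval N Y := (congrFun hμ χ).symm
    change μ.1 χ < _
    rw [h2]
    linarith
  · have h1 := abs_lt.1 (hχ M X hX)
    have h2 : χ.eval M X < 2 * ε / 3 := hO
    linarith

/-- Bump functions on the space of quantifier-free types that are given by formulas. -/
theorem exists_bump_formula {r : ℕ → ℝ} {O : Set (QFTypesOn.{u} r)} (hO : IsOpen O)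
    {μ : QFTypesOn.{u} r} (hμ : μ ∈ O) : ∃ b : QFFormula ℕ,
      (∀ ν : QFTypesOn.{u} r, 0 ≤ ν.1 b) ∧ 0 < μ.1 b ∧ ∀ ν : QFTypesOn.{u} r, 0 < ν.1 b → ν ∈ O := by
  obtain ⟨V, hV, rfl⟩ := isOpen_induced_iff.1 hO
  obtain ⟨I, v, hv, hIV⟩ := isOpen_pi_iff.1 hV μ.1 hμ
  have hpi : IsOpen (Set.univ.pi fun i : I => v i) :=
    isOpen_set_pi Set.finite_univ fun i _ => (hv i i.2).1
  -- A basic neighbourhood involves finitely many formulas; the bump is a tent function of the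
  -- distance to `μ` in those coordinates.
  obtain ⟨δ, hδ, hball⟩ := Metric.isOpen_iff.1 hpi (fun i : I => μ.1 i)
    (fun i _ => (hv i i.2).2)
  obtain ⟨b, hb⟩ := IsFormula.conn.{u} (κ := I)
    ⟨fun x => max 0 (δ - dist x fun i : I => μ.1 i), by fun_prop⟩
    (fun i => ⟨i.1, fun _ _ => rfl⟩)
  have hb' : ∀ ν : QFTypesOn.{u} r,
      ν.1 b = max 0 (δ - dist (fun i : I => ν.1 i) fun i : I => μ.1 i) := by
    rintro ⟨_, M, X, -, rfl⟩
    exact (hb M X).symm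
  refine ⟨b, fun ν => ?_, ?_, fun ν hν => hIV fun i hi => ?_⟩
  · rw [hb']
    exact le_max_left _ _
  · rw [hb', dist_self, sub_zero]
    exact lt_max_of_lt_right hδ
  · rw [hb', lt_max_iff] at hν
    have hd : dist (fun i : I => ν.1 i) (fun i : I => μ.1 i) < δ := by
      rcases hν with hν | hν
      · exact absurd hν (lt_irrefl _)
      · linarith
    exact hball hd ⟨i, hi⟩ (Set.mem_univ _)

/-- Finitely many bumps cover the compact type space; normalised, they form a partition of unity
gluing the local terms. -/
theorem exists_combination_approx {R : ℝ} {k : ℕ} {r : ℕ → ℝ} (hr : ∀ j, 0 < r j) {ε : ℝ}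
    (h : ∀ μ : QFTypesOn.{u} r, ∃ (g : Term ℕ) (O : Set (QFTypesOn.{u} r)), IsOpen O ∧ μ ∈ O ∧
      ∀ (M : TracialWStarAlgebra.{u}) (X : ℕ → M) (hX : ∀ j, X j ∈ M.D (r j)),
        g.eval M X ∈ M.D R ∧ (qfTypeOn M X hX ∈ O → M.d (f M X k) (g.eval M X) < ε)) :
    ∃ (m : ℕ) (φ : Fin m → QFFormula ℕ) (g : Fin m → Term ℕ),
      ∀ (M : TracialWStarAlgebra.{u}) (X : ℕ → M), (∀ j, X j ∈ M.D (r j)) →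
        ∑ j, (((φ j).eval M X : ℝ) : ℂ) • (g j).eval M X ∈ M.D R ∧
          M.d (f M X k) (∑ j, (((φ j).eval M X : ℝ) : ℂ) • (g j).eval M X) < ε := by
  choose g O hO hμO hg using h
  choose b hb0 hbμ hbO using fun μ => exists_bump_formula (hO μ) (hμO μ)
  have hK := isCompact_QFTypesOn.{u} hr
  obtain ⟨T, hT⟩ := hK.elim_finite_subcover (fun μ : QFTypesOn.{u} r => {ν | 0 < ν (b μ)})
    (fun μ => isOpen_lt continuous_const (continuous_apply _))
    (fun ν hν => Set.mem_iUnion.2 ⟨⟨ν, hν⟩, hbμ ⟨ν, hν⟩⟩)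
  let e := (Fintype.equivFin T).symm
  obtain ⟨η, hη, hsum⟩ : ∃ η : ℝ, 0 < η ∧ ∀ ν ∈ QFTypesOn.{u} r, η ≤ ∑ j, ν (b (e j)) := by
    refine hK.exists_forall_le' (a := 0) (f := fun ν => ∑ j, ν (b (e j)))
      (by fun_prop) fun ν hν => ?_
    obtain ⟨μ, hμ, hν0⟩ := Set.mem_iUnion₂.1 (hT hν)
    refine Finset.sum_pos' (fun j _ => hb0 _ ⟨ν, hν⟩)
      ⟨e.symm ⟨μ, hμ⟩, Finset.mem_univ _, ?_⟩
    rw [Equiv.apply_symm_apply]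
    exact hν0
  -- Connectives must be continuous everywhere; the maximum prevents division by zero and equals the
  -- sum on actual types.
  have hη' : ∀ x : Fin (Fintype.card T) → ℝ, max η (∑ i, x i) ≠ 0 := fun x =>
    (hη.trans_le (le_max_left _ _)).ne'
  choose φ hφ using fun j => IsFormula.conn.{u}
    ⟨fun x : Fin (Fintype.card T) → ℝ => x j / max η (∑ i, x i),
      Continuous.div (by fun_prop) (by fun_prop) hη'⟩
    (fun i => ⟨b (e i), fun _ _ => rfl⟩)
  refine ⟨Fintype.card T, φ, fun j => g (e j), fun M X hX => ?_⟩
  have hb : ∀ j, 0 ≤ (b (e j)).eval M X := fun j => hb0 _ (qfTypeOn M X hX)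
  have hs : η ≤ ∑ j, (b (e j)).eval M X := hsum _ (qfTypeOn M X hX).2
  have hφ' : ∀ j, (φ j).eval M X = (b (e j)).eval M X / ∑ i, (b (e i)).eval M X := fun j => by
    rw [← hφ]
    exact congrArg ((b (e j)).eval M X / ·) (max_eq_right hs)
  have hφ0 : ∀ j, 0 ≤ (φ j).eval M X := fun j => by
    rw [hφ']
    exact div_nonneg (hb j) (hη.le.trans hs)
  have hφ1 : ∑ j, (φ j).eval M X = 1 := by
    simp only [hφ', ← Finset.sum_div]
    exact div_self (hη.trans_le hs).ne'
  refine ⟨?_, TracialWStarAlgebra.d_sum_smul_le _ hφ0 hφ1 _ _ fun j hj => ?_⟩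
  · calc ‖∑ j, (((φ j).eval M X : ℝ) : ℂ) • (g (e j)).eval M X‖
        ≤ ∑ j, (φ j).eval M X * R := norm_sum_le_of_le _ fun j _ => by
          rw [norm_smul, Complex.norm_real, Real.norm_of_nonneg (hφ0 j)]
          exact mul_le_mul_of_nonneg_left (hg (e j) M X hX).1 (hφ0 j)
      _ = R := by rw [← Finset.sum_mul, hφ1, one_mul]
  · refine (hg (e j) M X hX).2 (hbO _ _ ?_)
    rw [hφ'] at hj
    exact (div_pos_iff_of_pos_right (hη.trans_le hs)).1 hj

/-- The combinations lie in the same domains as the values of `f`, so the modulus of continuity of a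
formula on those domains controls the error of replacing one by the other. -/
theorem isQFDefinableFunction_of_combination_approx {R : (ℕ → ℝ) → ℕ → ℝ}
    (hR : ∀ r : ℕ → ℝ, (∀ j, 0 < r j) → ∀ k, 0 < R r k)
    (hf : ∀ r : ℕ → ℝ, (∀ j, 0 < r j) →
      ∀ (M : TracialWStarAlgebra.{u}) (X : ℕ → M), (∀ j, X j ∈ M.D (r j)) →
        ∀ k, f M X k ∈ M.D (R r k))
    (h : ∀ (k : ℕ) (r : ℕ → ℝ), (∀ j, 0 < r j) → ∀ ε : ℝ, 0 < ε →
      ∃ (m : ℕ) (φ : Fin m → QFFormula ℕ) (g : Fin m → Term ℕ),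
        ∀ (M : TracialWStarAlgebra.{u}) (X : ℕ → M), (∀ j, X j ∈ M.D (r j)) →
          ∑ j, (((φ j).eval M X : ℝ) : ℂ) • (g j).eval M X ∈ M.D (R r k) ∧
            M.d (f M X k) (∑ j, (((φ j).eval M X : ℝ) : ℂ) • (g j).eval M X) < ε) :
    IsQFDefinableFunction f := by
  refine ⟨fun r hr => ⟨R r, hR r hr, hf r hr⟩, fun φ hφ r hr ε hε => ?_⟩
  let r₁ : ℕ → ℝ := fun j => r (Sum.inl j)
  have hr₁ : ∀ j, 0 < r₁ j := fun j => hr _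
  let r' : ℕ ⊕ ℕ → ℝ := Sum.elim (R r₁) fun j => r (Sum.inr j)
  have hr' : ∀ i, 0 < r' i := by
    rintro (k | j)
    exacts [hR r₁ hr₁ k, hr _]
  obtain ⟨ψ, hψ⟩ := hφ r' hr' (ε / 2) (by positivity)
  obtain ⟨δ, hδ, hcont⟩ := ψ.exists_uniform_continuity.{u} r' (ε / 2) (by positivity)
  choose m θ g hg using fun k => h k r₁ hr₁ δ hδ
  let s : ℕ → Term (ℕ ⊕ ℕ) := fun j => .var (Sum.inl j)
  let G : ℕ ⊕ ℕ → (M : TracialWStarAlgebra.{u}) → (ℕ ⊕ ℕ → M) → M := fun i M Z =>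
    Sum.elim (fun k => ∑ j, (((θ k j).eval M (fun i => Z (Sum.inl i)) : ℝ) : ℂ) •
      (g k j).eval M (fun i => Z (Sum.inl i))) (fun j => Z (Sum.inr j)) i
  have hG : ∀ i, IsFormulaCombination (G i) := by
    rintro (k | j)
    · refine ⟨Fin (m k), inferInstance, fun j => (θ k j).bind s, fun j => (g k j).bind s,
        fun M Z => ?_⟩
      simp only [QFFormula.eval_bind, Term.eval_bind]
      rfl
    · exact IsFormulaCombination.of_term (.var (Sum.inr j))
  obtain ⟨χ, hχ⟩ := IsFormulaCombination.bind_formula hG ψ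
  refine ⟨χ, fun M Z hZ => ?_⟩
  have hZ₁ : ∀ j, Z (Sum.inl j) ∈ M.D (r₁ j) := fun j => hZ _
  let W : ℕ ⊕ ℕ → M := Sum.elim (f M fun j => Z (Sum.inl j)) fun j => Z (Sum.inr j)
  have hW : ∀ i, W i ∈ M.D (r' i) := by
    rintro (k | j)
    exacts [hf r₁ hr₁ M _ hZ₁ k, hZ _]
  have h1 := hψ M W hW
  have h2 := hcont M W (fun i => G i M Z) hW
    (by rintro (k | j); exacts [(hg k M _ hZ₁).1, hZ _])
    (by
      rintro (k | j)
      exacts [(hg k M _ hZ₁).2.le, (TracialWStarAlgebra.d_self _).trans_le hδ.le])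
  rw [← hχ]
  calc |φ M W - ψ.eval M fun i => G i M Z|
      ≤ |φ M W - ψ.eval M W| + |ψ.eval M W - ψ.eval M fun i => G i M Z| := abs_sub_le _ _ _
    _ < ε := by linarith

end

end Ltr

open Ltr

theorem mainTheorem11
    (f : (M : TracialWStarAlgebra.{u}) → (ℕ → M) → (ℕ → M))
    (R : (ℕ → ℝ) → ℕ → ℝ)
    (hR : ∀ r : ℕ → ℝ, (∀ j, 0 < r j) → ∀ k, 0 < R r k)
    (hf : ∀ r : ℕ → ℝ, (∀ j, 0 < r j) →
      ∀ (M : TracialWStarAlgebra.{u}) (X : ℕ → M), (∀ j, X j ∈ M.D (r j)) →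
        ∀ k, f M X k ∈ M.D (R r k)) :
    List.TFAE [
      IsQFDefinableFunction f,
      ∀ k : ℕ, IsQFDefinablePredicate
        (fun (M : TracialWStarAlgebra.{u}) (Z : ℕ ⊕ Unit → M) =>
          M.d (f M (fun j => Z (Sum.inl j)) k) (Z (Sum.inr ()))),
      ∀ (k : ℕ) (r : ℕ → ℝ), (∀ j, 0 < r j) → ∀ (μ : QFTypesOn.{u} r) (ε : ℝ), 0 < ε →
        ∃ (g : Term ℕ) (O : Set (QFTypesOn.{u} r)), IsOpen O ∧ μ ∈ O ∧
          ∀ (M : TracialWStarAlgebra.{u}) (X : ℕ → M) (hX : ∀ j, X j ∈ M.D (r j)),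
            g.eval M X ∈ M.D (R r k) ∧
              (qfTypeOn M X hX ∈ O → M.d (f M X k) (g.eval M X) < ε),
      ∀ (k : ℕ) (r : ℕ → ℝ), (∀ j, 0 < r j) → ∀ ε : ℝ, 0 < ε →
        ∃ (m : ℕ) (φ : Fin m → QFFormula ℕ) (g : Fin m → Term ℕ),
          ∀ (M : TracialWStarAlgebra.{u}) (X : ℕ → M), (∀ j, X j ∈ M.D (r j)) →
            ∑ j, (((φ j).eval M X : ℝ) : ℂ) • (g j).eval M X ∈ M.D (R r k) ∧
              M.d (f M X k) (∑ j, (((φ j).eval M X : ℝ) : ℂ) • (g j).eval M X) < ε] := by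
  tfae_have 1 → 2 := fun h k => h.dist_definable k
  tfae_have 2 → 3 := fun h k r hr μ ε hε =>
    exists_local_term_approx (hR r hr k) (h k) hr (fun M X hX => hf r hr M X hX k) μ hε
  tfae_have 3 → 4 := fun h k r hr ε hε =>
    exists_combination_approx hr fun μ => h k r hr μ ε hε
  tfae_have 4 → 1 := isQFDefinableFunction_of_combination_approx hR hf
  tfae_finish
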